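/- Let $r\ge 2$ be an integer. Let $K$ be a commutative $\mathbb{Q}$-algebra (for example $\mathbb{C}$, or the ring of Laurent polynomials in $c_{r-1}$ with coefficients polynomial in the other parameters), and let $Q,\Delta,\mathsf{c},c_0',c_0,c_1,\dots,c_{r-1}\in K$ be parameters with $c_{r-1}$ invertible. Here $\mathsf{c}$ is the Virasoro central charge, and $\Delta=\Delta_{c_0}$ is the weight attached to $c_0$ (an arbitrary element of $K$, for instance $c_0(Q-c_0)$). Let $c_r$ be a formal variable and put $c_j=0$ for $j>r$. For $n\ge1$ set $$\Lambda_n=((n+1)Q-c_0)c_n-\sum_{k=1}^{n-1}c_kc_{n-k},$$ and let $\Lambda_n'$ be given by the same formula with $c_0$ replaced by $c_0'$ and $c_j$ replaced by $0$ for all $j\ge r$. Let $\mathrm{Vir}$ be the Virasoro algebra over $K$, with $[L_m,L_n]=(m-n)L_{m+n}+\frac{c}{12}(m^3-m)\delta_{m+n,0}$ and $c$ central. Let $\mathcal{M}$ be the irregular Verma module of rank $r-1$: the $\mathrm{Vir}$-module of central charge $\mathsf{c}$ induced from the one-dimensional representation $L_n\mapsto\Lambda_n'$ $(n\ge r-1)$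 of the subalgebra spanned by the $L_n$ with $n\ge r-1$ and $c$. Write $|I^{(r-1)}\rangle$ for its generator; thus $L_n|I^{(r-1)}\rangle=\Lambda_n'|I^{(r-1)}\rangle$ for $n=r-1,\dots,2r-2$, and $L_n|I^{(r-1)}\rangle=0$ for $n>2r-2$. For a partition $\lambda=(\lambda_1\ge\dots\ge\lambda_\ell>0)$ put $L_{-\lambda}=L_{-\lambda_1+r-1}\cdots L_{-\lambda_\ell+r-1}$. The constant term of $u\in\mathcal{M}$ is the coefficient of $|I^{(r-1)}\rangle$ in the expansion of $u$ in the vectors $L_{-\lambda}|I^{(r-1)}\rangle$. Let $M$ be the $r\times r$ anti-triangular matrix whose entry in row $n+1$ $(0\le n\le r-1)$ and column $k$ $(1\le k\le r)$ is $k\,c_{n+k}$; it is invertible over $K((c_r))$. Put $D_0=L_0-\Delta$, $D_n=L_n-\Lambda_n$ for $1\le n\le r-1$, and $$L_*=c_r^{\,r}\sum_{n=0}^{r-1}(M^{-1})_{r,n+1}D_n .$$ Then there is a unique formal series $$W=c_r^{\nu_r}\exp\Bigl(\sum_{k=1}^{r-1}\frac{g_k}{c_r^{k}}\Bigr)\sum_{k=0}^{\infty}c_r^{k}v_k,\qquad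 \nu_r,g_k\in K,\quad v_k\in\mathcal{M},\quad v_0=|I^{(r-1)}\rangle,$$ that satisfies $$L_*W=c_r^{\,r}\,\frac{\partial W}{\partial c_r},\qquad L_nW=\Lambda_nW\quad(n=r,r+1,\dots,2r).$$ Here uniqueness means uniqueness of $\nu_r$, of the $g_k$ and of the $v_k$. The operators $L_n$ act coefficientwise and $\partial/\partial c_r$ acts formally by the Leibniz rule. Moreover $\nu_r$, every $g_k$ and the constant term of every $v_k$ (which is well defined) are the values at the given parameters of universal polynomials, depending only on $r$ and on the quantity in question, with rational coefficients, in $Q,\Delta,\mathsf{c},c_0',c_0,c_1,\dots,c_{r-1},c_{r-1}^{-1}$. -/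

import Mathlib

/-! ## The Virasoro algebra -/

/-- The Virasoro algebra over a `ℚ`-algebra `K`, as a `K`-module: finite combinations of
`L_n` (`n ∈ ℤ`) together with the central direction. -/
def Virasoro (K : Type*) [CommRing K] : Type _ := (ℤ →₀ K) × K

namespace Virasoro

variable (K : Type*) [CommRing K]

noncomputable instance : AddCommGroup (Virasoro K) := inferInstanceAs (AddCommGroup ((ℤ →₀ K) × K))

noncomputable instance : Module K (Virasoro K) := inferInstanceAs (Module K ((ℤ →₀ K) × K))

/-- The generator `L_n`. -/
noncomputable def L (n : ℤ) : Virasoro K := ((Finsupp.single n (1 : K), (0 : K)) : (ℤ →₀ K) × K)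

/-- The central generator `c`. -/
noncomputable def central : Virasoro K := (((0 : ℤ →₀ K), (1 : K)) : (ℤ →₀ K) × K)

/-- The projection onto the span of the `L_n`. -/
noncomputable def proj : Virasoro K →ₗ[K] (ℤ →₀ K) := LinearMap.fst K (ℤ →₀ K) K

@[simp] theorem proj_L (n : ℤ) : proj K (L K n) = Finsupp.single n 1 := rfl

@[simp] theorem proj_central : proj K (central K) = 0 := rfl

variable [Algebra ℚ K]

/-- `[L_m, L_n] = (m - n) L_{m+n} + (c / 12) (m³ - m) δ_{m+n,0}`. -/
noncomputable def bracketBasis (m n : ℤ) : Virasoro K :=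
  ((m - n : ℤ) : K) • L K (m + n) +
    (if m + n = 0 then algebraMap ℚ K (((m : ℚ) ^ 3 - m) / 12) else 0) • central K

/-- The bilinear extension of `bracketBasis`. -/
noncomputable def bracketAux : (ℤ →₀ K) →ₗ[K] (ℤ →₀ K) →ₗ[K] Virasoro K :=
  Finsupp.linearCombination K fun m => Finsupp.linearCombination K fun n => bracketBasis K m n

noncomputable instance : Bracket (Virasoro K) (Virasoro K) where
  bracket x y := bracketAux K (proj K x) (proj K y)

theorem bracket_def (x y : Virasoro K) : ⁅x, y⁆ = bracketAux K (proj K x) (proj K y) := rfl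

@[simp] theorem bracketAux_single (m n : ℤ) (a b : K) :
    bracketAux K (Finsupp.single m a) (Finsupp.single n b) = (a * b) • bracketBasis K m n := by
  simp [bracketAux, Finsupp.linearCombination_single, mul_smul]

theorem bracketBasis_antisymm (m n : ℤ) : bracketBasis K n m = -bracketBasis K m n := by
  unfold bracketBasis
  rw [add_comm n m, neg_add, ← neg_smul, ← neg_smul]
  congr 2
  · push_cast; ring
  · split_ifs with h
    · obtain rfl : n = -m := by omega
      rw [← map_neg]; congr 1; push_cast; ring
    · simp

theorem bracketAux_antisymm (x y : ℤ →₀ K) : bracketAux K y x = -bracketAux K x y := by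
  induction x using Finsupp.induction_linear with
  | zero => simp
  | add f g hf hg => rw [map_add, map_add, LinearMap.add_apply, hf, hg, neg_add]
  | single m a =>
    induction y using Finsupp.induction_linear with
    | zero => simp
    | add f g hf hg => rw [map_add, map_add, LinearMap.add_apply, hf, hg, neg_add]
    | single n b =>
      rw [bracketAux_single, bracketAux_single, bracketBasis_antisymm K m n, smul_neg, mul_comm]

theorem bracketAux_single_basis (k m n : ℤ) (a : K) :
    bracketAux K (Finsupp.single k a) (proj K (bracketBasis K m n)) =
      (a * ((m - n : ℤ) : K)) • bracketBasis K k (m + n) := by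
  simp only [bracketBasis, map_add, map_smul, proj_L, proj_central, smul_zero, add_zero,
    bracketAux_single, smul_smul]
  congr 1; ring

theorem jacobi_basis (k m n : ℤ) :
    ((m - n : ℤ) : K) • bracketBasis K k (m + n) =
      -(((k - m : ℤ) : K) • bracketBasis K n (k + m)) +
        ((k - n : ℤ) : K) • bracketBasis K m (k + n) := by
  have e1 : n + (k + m) = k + (m + n) := by ring
  have e2 : m + (k + n) = k + (m + n) := by ring
  simp only [bracketBasis, e1, e2, smul_add, smul_smul]
  split_ifs with h
  · obtain rfl : k = -(m + n) := by omega
    have hc : ∀ z : ℤ, (z : K) = algebraMap ℚ K (z : ℚ) := fun z => by simp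
    simp only [hc, ← map_mul]
    rw [neg_add (algebraMap ℚ K _ • L K _), add_add_add_comm]
    simp only [← neg_smul, ← add_smul, ← map_neg, ← map_add]
    congr 3
    · push_cast; ring
    · push_cast; ring
  · simp only [mul_zero, zero_smul, add_zero]
    rw [← neg_smul, ← add_smul]
    congr 1
    push_cast; ring

theorem jacobi_aux (x y z : ℤ →₀ K) :
    bracketAux K x (proj K (bracketAux K y z)) =
      -bracketAux K z (proj K (bracketAux K x y)) +
        bracketAux K y (proj K (bracketAux K x z)) := by
  induction x using Finsupp.induction_linear with
  | zero => simp
  | add f g hf hg => simp only [map_add, LinearMap.add_apply, hf, hg]; abel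
  | single k a =>
    induction y using Finsupp.induction_linear with
    | zero => simp
    | add f g hf hg => simp only [map_add, LinearMap.add_apply, hf, hg]; abel
    | single m b =>
      induction z using Finsupp.induction_linear with
      | zero => simp
      | add f g hf hg => simp only [map_add, LinearMap.add_apply, hf, hg]; abel
      | single n d =>
        simp only [bracketAux_single, map_smul, bracketAux_single_basis, smul_smul]
        have h := congrArg (fun t => (a * b * d) • t) (jacobi_basis K k m n)
        simp only [smul_add, smul_neg, smul_smul] at h
        convert h using 2
        · ring
        · congr 2; ring
        · congr 1; ring

noncomputable instance : LieRing (Virasoro K) where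
  add_lie x y z := by simp [bracket_def]
  lie_add x y z := by simp [bracket_def]
  lie_self x := by
    have h := bracketAux_antisymm K (proj K x) (proj K x)
    have h2 : (2 : K) • bracketAux K (proj K x) (proj K x) = 0 := by
      rw [two_smul]; nth_rewrite 1 [h]; simp
    have h3 := congrArg (fun t => algebraMap ℚ K (1 / 2) • t) h2
    have h4 : algebraMap ℚ K (1 / 2) * 2 = 1 := by
      rw [← map_ofNat (algebraMap ℚ K) 2, ← map_mul]; norm_num
    simp only [smul_smul, h4, one_smul, smul_zero] at h3
    exact h3
  leibniz_lie x y z := by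
    simp only [bracket_def]
    rw [jacobi_aux, ← bracketAux_antisymm]

noncomputable instance : LieAlgebra K (Virasoro K) where
  lie_smul t x y := by simp [bracket_def]

theorem lie_L_L (m n : ℤ) :
    ⁅L K m, L K n⁆ = ((m - n : ℤ) : K) • L K (m + n) +
      (if m + n = 0 then algebraMap ℚ K (((m : ℚ) ^ 3 - m) / 12) else 0) • central K := by
  simp [bracket_def, bracketBasis]

theorem lie_central (x : Virasoro K) : ⁅x, central K⁆ = 0 := by
  simp [bracket_def]

end Virasoro

/-! ## Parameters -/

/-- `Λ_n = ((n + 1) Q - c_0) c_n - ∑_{k=1}^{n-1} c_k c_{n-k}`; only the values `c j` with `j ≥ 1`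
are used. -/
def irregularWeight {R : Type*} [CommRing R] (Q c₀ : R) (c : ℕ → R) (n : ℕ) : R :=
  (((n : R) + 1) * Q - c₀) * c n - ∑ k ∈ Finset.Icc 1 (n - 1), c k * c (n - k)

/-- The parameters of the rank `r` construction, apart from the expansion variable `c_r`. -/
structure IrregularParams (K : Type*) (r : ℕ) where
  /-- the value of the central element of the Virasoro algebra -/
  centralCharge : K
  /-- the background charge `Q` -/
  Q : K
  /-- the scalar `Δ_{c_0}` subtracted from `L_0` -/
  Δ : K
  /-- the parameter `c_0'` of the rank `r - 1` vector -/
  c₀' : K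
  /-- the parameter `c_0` of the rank `r` vector -/
  c₀ : K
  /-- `c_1, …, c_{r-1}`; the entry with index `i` is `c_{i+1}` -/
  c : Fin (r - 1) → K

/-- Names for the variables of Laurent polynomials in the parameters: all the parameters, and the
inverse of `c_{r-1}`. -/
inductive ParamVar (r : ℕ) where
  | centralCharge : ParamVar r
  | Q : ParamVar r
  | Δ : ParamVar r
  | c₀' : ParamVar r
  | c₀ : ParamVar r
  | c : Fin (r - 1) → ParamVar r
  | cTopInv : ParamVar r

namespace IrregularParams

variable {K : Type*} [CommRing K] {r : ℕ} (p : IrregularParams K r)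

/-- `c_j` for the rank `r - 1` vector: zero unless `1 ≤ j ≤ r - 1`. -/
def lower (j : ℕ) : K :=
  if h : 1 ≤ j ∧ j ≤ r - 1 then p.c ⟨j - 1, by omega⟩ else 0

/-- `Λ'_n`, the weights of the rank `r - 1` vector. -/
def lowerWeight (n : ℕ) : K := irregularWeight p.Q p.c₀' p.lower n

/-- The values of the variables of Laurent polynomials at the given parameters. -/
noncomputable def value : ParamVar r → K
  | .centralCharge => p.centralCharge
  | .Q => p.Q
  | .Δ => p.Δ
  | .c₀' => p.c₀'
  | .c₀ => p.c₀
  | .c i => p.c i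
  | .cTopInv => Ring.inverse (p.lower (r - 1))

/-- The expansion variable `c_r`, as an element of the ring `K((c_r))`. -/
noncomputable def top (_p : IrregularParams K r) : LaurentSeries K := HahnSeries.single 1 1

/-- `c_j ∈ K((c_r))` for the rank `r` vector: `c_1, …, c_{r-1}` are constants, `c_r` is the
variable, and all the others vanish. -/
noncomputable def upper (j : ℕ) : LaurentSeries K :=
  if j = r then p.top else HahnSeries.C (p.lower j)

/-- `Λ_n ∈ K((c_r))`, the weights of the rank `r` vector. -/
noncomputable def weight (n : ℕ) : LaurentSeries K :=
  irregularWeight (HahnSeries.C p.Q) (HahnSeries.C p.c₀) p.upper n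

/-- The anti-triangular coefficient matrix of the vector fields
`𝒟_n = ∑_{k=1}^{r-n} k c_{n+k} ∂/∂c_k` (`0 ≤ n ≤ r - 1`): the entry in the row of `𝒟_n` and the
column of `∂/∂c_k` is `k c_{n+k}`, which vanishes for `n + k > r`. -/
noncomputable def fieldMatrix : Matrix (Fin r) (Fin r) (LaurentSeries K) :=
  Matrix.of fun n k => (((k : ℕ) + 1 : ℕ) : LaurentSeries K) * p.upper (n + (k + 1))

/-! ## The irregular Verma module of rank `r - 1` -/

variable [Algebra ℚ K]

/-- `L_n` in the universal enveloping algebra. -/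
noncomputable def genU (K : Type*) [CommRing K] [Algebra ℚ K] (n : ℤ) :
    UniversalEnvelopingAlgebra K (Virasoro K) :=
  UniversalEnvelopingAlgebra.ι K (Virasoro.L K n)

/-- The left ideal generated by `L_n - Λ'_n` (`n ≥ r - 1`) and by the difference of the central
element and its value. -/
noncomputable def vermaIdeal :
    Submodule (UniversalEnvelopingAlgebra K (Virasoro K))
      (UniversalEnvelopingAlgebra K (Virasoro K)) :=
  Submodule.span _
    ({x | ∃ n : ℕ, r - 1 ≤ n ∧ x = genU K n - algebraMap K _ (p.lowerWeight n)} ∪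
      {UniversalEnvelopingAlgebra.ι K (Virasoro.central K) - algebraMap K _ p.centralCharge})

/-- The irregular Verma module of rank `r - 1`: the module induced from the one-dimensional
representation `L_n ↦ Λ'_n` of the subalgebra spanned by `L_n` (`n ≥ r - 1`) and the centre, that
is, the quotient of the enveloping algebra by the corresponding left ideal. -/
abbrev Verma : Type _ := UniversalEnvelopingAlgebra K (Virasoro K) ⧸ p.vermaIdeal

/-- The generator `|I^{(r-1)}⟩`. -/
noncomputable def vac : p.Verma := Submodule.Quotient.mk 1

/-- The vector `L_{-λ} |I^{(r-1)}⟩`, with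
`L_{-λ} = L_{-λ_1+r-1} ⋯ L_{-λ_ℓ+r-1}` for a partition `λ_1 ≥ ⋯ ≥ λ_ℓ > 0`. -/
noncomputable def pbw {m : ℕ} (lam : m.Partition) : p.Verma :=
  ((lam.parts.sort (· ≥ ·)).map fun i : ℕ => genU K ((r : ℤ) - 1 - i)).prod • p.vac

/-- `a` is the constant term `{u}` of `u`: the coefficient of `|I^{(r-1)}⟩` in an expansion of `u`
in the vectors `L_{-λ} |I^{(r-1)}⟩`. -/
def IsConstantTerm (u : p.Verma) (a : K) : Prop :=
  u - a • p.vac ∈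
    Submodule.span K {x : p.Verma | ∃ (m : ℕ) (lam : m.Partition), 0 < m ∧ x = p.pbw lam}

/-! ## Formal series -/

/-- Formal Laurent series in `c_r` with coefficients in the irregular Verma module, a module over
the ring `K((c_r))`. -/
abbrev VermaSeries : Type _ := HahnModule ℤ K p.Verma

/-- The action of `L_n` on series, coefficient by coefficient. -/
noncomputable def modeL (n : ℤ) (F : p.VermaSeries) : p.VermaSeries :=
  HahnModule.of K
    (((HahnModule.of K).symm F).map (Algebra.lsmul K K p.Verma (genU K n)))

/-- The operators `D_0 = L_0 - Δ_{c_0}` and `D_n = L_n - Λ_n` (`n ≥ 1`). -/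
noncomputable def modeD (n : ℕ) (F : p.VermaSeries) : p.VermaSeries :=
  p.modeL n F - (if n = 0 then HahnSeries.C p.Δ else p.weight n) • F

/-- The operator `L_* = c_r^r ∑_{n=0}^{r-1} (M⁻¹)_{r,n+1} D_n`. -/
noncomputable def Lstar (hr : 2 ≤ r) (F : p.VermaSeries) : p.VermaSeries :=
  p.top ^ r • ∑ n : Fin r, (p.fieldMatrix⁻¹) ⟨r - 1, by omega⟩ n • p.modeD n F

/-- The formal derivative `∑ F_n c_r^n ↦ ∑ n F_n c_r^{n-1}`. -/
noncomputable def formalDeriv (F : p.VermaSeries) : p.VermaSeries :=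
  HahnModule.of K (LaurentSeries.hasseDeriv K 1 ((HahnModule.of K).symm F))

end IrregularParams

/-- The data of a formal series
`c_r^ν exp(∑_{k=1}^{r-1} g_k / c_r^k) ∑_{k≥0} c_r^k v_k` with `v_k` in the irregular Verma module;
the entry of `g` with index `i` is `g_{i+1}`. -/
structure IrregularSeries {K : Type*} [CommRing K] [Algebra ℚ K] {r : ℕ}
    (p : IrregularParams K r) where
  /-- the exponent `ν_r` -/
  ν : K
  /-- the coefficients `g_1, …, g_{r-1}` -/
  g : Fin (r - 1) → K
  /-- the coefficients `v_0, v_1, …` -/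
  v : ℕ → p.Verma

namespace IrregularSeries

variable {K : Type*} [CommRing K] [Algebra ℚ K] {r : ℕ} {p : IrregularParams K r}
  (W : IrregularSeries p)

/-- The factor `∑_{k≥0} c_r^k v_k`. -/
noncomputable def body : p.VermaSeries :=
  HahnModule.of K (HahnSeries.ofSuppBddBelow
    (fun n : ℤ => if 0 ≤ n then W.v n.toNat else 0)
    ⟨0, fun n hn => by
      by_contra h
      exact hn (if_neg h)⟩)

/-- The logarithmic derivative `ν / c_r - ∑_k k g_k / c_r^{k+1}` of the prefactor
`c_r^ν exp(∑_k g_k / c_r^k)`. -/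
noncomputable def logDeriv : LaurentSeries K :=
  HahnSeries.single (-1) W.ν -
    ∑ i : Fin (r - 1), HahnSeries.single (-((i : ℤ) + 2)) ((((i : ℕ) + 1 : ℕ) : K) * W.g i)

/-- `∂/∂c_r` on vectors of the form `c_r^ν exp(∑_k g_k / c_r^k) F`, where `F` is a Laurent series
in `c_r`. Such a vector is represented by `F`; by the Leibniz rule, its derivative is
the prefactor times `F' + (log of the prefactor)' F`. The operators `L_n` and the multiplications
by elements of `K((c_r))` commute with the prefactor, so they act on `F`. -/
noncomputable def partialTop (F : p.VermaSeries) : p.VermaSeries :=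
  p.formalDeriv F + W.logDeriv • F

/-- The conditions on the formal vector `W`: its leading coefficient is `v_0 = |I^{(r-1)}⟩`, it
satisfies `L_* W = c_r^r ∂W/∂c_r`, and `L_n W = Λ_n W` for `r ≤ n ≤ 2 r`. The common prefactor is
cancelled from both sides of each equation. -/
structure IsCanonical (hr : 2 ≤ r) : Prop where
  leading : W.v 0 = p.vac
  lstar : p.Lstar hr W.body = p.top ^ r • W.partialTop W.body
  higher : ∀ n : ℕ, r ≤ n → n ≤ 2 * r → p.modeL n W.body = p.weight n • W.body

end IrregularSeries

/-!
The equations are solved in two steps: first the equations `L_n W = Λ_n W` for `n ≥ r`, which make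
sense without the prefactor and determine `W` up to a scalar series, and then the equation for
`L_*`, which becomes a differential equation for that scalar series.

Write `s = r - 1`. The irregular Verma module is filtered by the weight of words in the `L_{s-i}`,
`i ≥ 1`, and `T_j = L_{s+j} - Λ'_{s+j}` lowers the weight by `j`. As `Λ'_{2s} = -c_s²` is
invertible, the operator `∑_{j ≥ 1} L_{s-j} T_j` acts on vectors of weight `d`, modulo lower weight,
as a unit multiple of `d`. Radial integration with respect to this Euler operator shows that the
common kernel of the `T_j`, `j ≥ 1`, is spanned by the irregular vector
(`IrregularModes.exists_eq_smul_vac_of_lower_eq_zero`), and that every cocycle of bounded weight of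
the Lie algebra they span is a coboundary (`IrregularModes.exists_lower_eq`). For `n ≥ r` the weight
`Λ_n` is `Λ'_n` plus terms linear and quadratic in `c_r`, so the coefficients of a series `G` such
that `L_n G = Λ_n G` can be constructed one after another; requiring that the constant terms of the
coefficients in positive degree vanish makes `G` unique, and every solution is `f G` with a scalar
series `f`. It suffices to impose the equations for `r ≤ n ≤ 2 r`, the other `L_n` being
commutators.

The operator `L_* - c_r^r ∂/∂c_r` preserves the equations for `n ≥ r`, because the vector fields
`𝒟_k = ∑_j j c_{k+j} ∂/∂c_j` satisfy `𝒟_k Λ_n = (n - k) Λ_{n+k}` (`sub_mul_irregularWeight`) and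
`L_*` is built from the matrix expressing `∂/∂c_r` through them. Hence it maps `G` to `H G` with a
scalar power series `H`, and the equation for `W = c_r^ν exp(∑ g_k / c_r^k) A G` becomes the
equation `c_r^r A' + P A = A H`, where `P` is `c_r^r` times the logarithmic derivative of the
prefactor. It has a power series solution with `A(0) = 1` exactly when `P` is the part of `H` of
degree less than `r`, and then only one (`PowerSeries.existsUnique_irregularODE`).

The constant term of a vector is well defined because sorting words with the Virasoro relations is
confluent (`VirasoroWord.constTerm_eq_swapped`). Finally, the result holds over the ring of Laurent
polynomials in the parameters; the solution over any other ring is the image of this universal one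
under base change, by uniqueness, so its exponents and constant terms are values of universal
Laurent polynomials.
-/

/-! ### Modules with an irregular vector -/

/-- A `K`-module with operators `L_n` satisfying the Virasoro relations at a fixed central charge,
together with a vector `vac` which is a simultaneous eigenvector of the `L_n` with `n ≥ s`.  The
eigenvalues vanish beyond `2 s`, and the one of `L_{2s}` is `-κ` with `κ` invertible. -/
structure IrregularModes (K V : Type*) [CommRing K] [Algebra ℚ K] [AddCommGroup V]
    [Module K V] where
  /-- the operators `L_n` -/
  mode : ℤ → Module.End K V
  /-- the central charge -/
  charge : K
  /-- the rank -/
  s : ℕ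
  /-- the irregular vector -/
  vac : V
  /-- the eigenvalues of the operators `L_n` on the irregular vector, for `n ≥ s` -/
  eig : ℕ → K
  /-- minus the eigenvalue of `L_{2s}` -/
  κ : K
  one_le_s : 1 ≤ s
  comm : ∀ (m n : ℤ) (x : V), mode m (mode n x) = mode n (mode m x) +
    ((m - n : ℤ) : K) • mode (m + n) x +
      (if m + n = 0 then algebraMap ℚ K (((m : ℚ) ^ 3 - m) / 12) * charge else 0) • x
  mode_vac : ∀ n : ℕ, s ≤ n → mode n vac = eig n • vac
  eig_of_lt : ∀ n : ℕ, 2 * s < n → eig n = 0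
  eig_two_mul : eig (2 * s) = -κ
  isUnit_κ : IsUnit κ

namespace IrregularModes

variable {K V : Type*} [CommRing K] [Algebra ℚ K] [AddCommGroup V] [Module K V]
  (S : IrregularModes K V)

/-- The product `L_{s-i_1} ⋯ L_{s-i_k}` applied to the irregular vector. -/
def word (w : List ℕ) : V := (w.map fun i : ℕ => S.mode (S.s - i)).prod S.vac

@[simp] theorem word_nil : S.word [] = S.vac := rfl

@[simp] theorem word_cons (i : ℕ) (w : List ℕ) :
    S.word (i :: w) = S.mode (S.s - i) (S.word w) := by
  simp [word]

/-- The span of the words of weight at most `d`, where the letter `L_{s-i}` has weight `i`. -/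
def filt (d : ℤ) : Submodule K V :=
  Submodule.span K {x | ∃ w : List ℕ, (∀ i ∈ w, 1 ≤ i) ∧ (w.sum : ℤ) ≤ d ∧ x = S.word w}

theorem word_mem_filt {w : List ℕ} (hw : ∀ i ∈ w, 1 ≤ i) {d : ℤ} (hd : (w.sum : ℤ) ≤ d) :
    S.word w ∈ S.filt d :=
  Submodule.subset_span ⟨w, hw, hd, rfl⟩

theorem filt_mono {d e : ℤ} (h : d ≤ e) : S.filt d ≤ S.filt e :=
  Submodule.span_mono fun _ ⟨w, hw, hd, hx⟩ => ⟨w, hw, hd.trans h, hx⟩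

@[elab_as_elim]
theorem filt_induction {d : ℤ} {p : ∀ x, x ∈ S.filt d → Prop}
    (word : ∀ (w : List ℕ) (hw : ∀ i ∈ w, 1 ≤ i) (hd : (w.sum : ℤ) ≤ d),
      p (S.word w) (S.word_mem_filt hw hd))
    (zero : p 0 (zero_mem _)) (add : ∀ x y hx hy, p x hx → p y hy → p (x + y) (add_mem hx hy))
    (smul : ∀ (a : K) x hx, p x hx → p (a • x) (Submodule.smul_mem _ a hx))
    {x : V} (hx : x ∈ S.filt d) : p x hx := by
  induction hx using Submodule.span_induction with
  | mem x h => obtain ⟨w, hw, hd, rfl⟩ := h; exact word w hw hd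
  | zero => exact zero
  | add x y _ _ hx hy => exact add x y _ _ hx hy
  | smul a x _ hx => exact smul a x _ hx

theorem vac_mem_filt : S.vac ∈ S.filt 0 := S.word_mem_filt (w := []) (by simp) (by simp)

theorem filt_eq_zero_of_neg {d : ℤ} (hd : d < 0) {x : V} (hx : x ∈ S.filt d) : x = 0 := by
  induction hx using S.filt_induction with
  | word w _ h => omega
  | zero => rfl
  | add x y _ _ hx hy => rw [hx, hy, add_zero]
  | smul a x _ hx => rw [hx, smul_zero]

theorem exists_eq_smul_vac {x : V} (hx : x ∈ S.filt 0) : ∃ a : K, x = a • S.vac := by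
  induction hx using S.filt_induction with
  | word w hw h =>
    cases w with
    | nil => exact ⟨1, by simp⟩
    | cons i w =>
      have := hw i (by simp)
      simp only [List.sum_cons] at h
      omega
  | zero => exact ⟨0, by simp⟩
  | add x y _ _ hx hy =>
    obtain ⟨a, rfl⟩ := hx
    obtain ⟨b, rfl⟩ := hy
    exact ⟨a + b, by rw [add_smul]⟩
  | smul a x _ hx =>
    obtain ⟨b, rfl⟩ := hx
    exact ⟨a * b, by rw [mul_smul]⟩

/-- The operator `L_{s+j}` with its eigenvalue on the irregular vector subtracted. -/
def lower (j : ℕ) : Module.End K V := S.mode ((S.s + j : ℕ) : ℤ) - S.eig (S.s + j) • 1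

theorem lower_apply (j : ℕ) (x : V) :
    S.lower j x = S.mode ((S.s + j : ℕ) : ℤ) x - S.eig (S.s + j) • x := by
  simp [lower]

theorem mode_eq_lower_add (j : ℕ) (x : V) :
    S.mode ((S.s + j : ℕ) : ℤ) x = S.lower j x + S.eig (S.s + j) • x := by
  rw [lower_apply, sub_add_cancel]

@[simp] theorem lower_vac (j : ℕ) : S.lower j S.vac = 0 := by
  rw [lower_apply, S.mode_vac _ (by omega), sub_self]

theorem raise_mem_filt {i : ℕ} (hi : 1 ≤ i) {d : ℤ} {x : V} (hx : x ∈ S.filt d) :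
    S.mode (S.s - i) x ∈ S.filt (d + i) := by
  induction hx using S.filt_induction with
  | word w hw h =>
    rw [← S.word_cons]
    refine S.word_mem_filt ?_ ?_
    · simpa [hi] using hw
    · rw [List.sum_cons, Nat.cast_add]; omega
  | zero => simp
  | add x y _ _ hx hy => rw [map_add]; exact add_mem hx hy
  | smul a x _ hx => rw [map_smul]; exact Submodule.smul_mem _ _ hx

theorem mode_mem_filt_of_lower {d : ℤ} {x : V} (hx : x ∈ S.filt d)
    (hT : ∀ j : ℕ, S.lower j x ∈ S.filt (d - j)) (k e : ℤ) (hke : -k ≤ e)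
    (he : k ≤ S.s → 0 ≤ e) : S.mode (S.s + k) x ∈ S.filt (d + e) := by
  rcases lt_or_ge k 0 with hk | hk
  · obtain ⟨i, rfl⟩ : ∃ i : ℕ, k = -i := ⟨k.natAbs, by omega⟩
    rw [← sub_eq_add_neg]
    exact S.filt_mono (by omega) (S.raise_mem_filt (i := i) (by omega) hx)
  · obtain ⟨j, rfl⟩ : ∃ i : ℕ, k = i := ⟨k.natAbs, by omega⟩
    have := S.mode_eq_lower_add j x
    push_cast at this
    rw [this]
    refine add_mem (S.filt_mono (by omega) (hT j)) ?_
    by_cases hj : j ≤ S.s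
    · exact Submodule.smul_mem _ _ (S.filt_mono (by have := he (by omega); omega) hx)
    · rw [S.eig_of_lt _ (by omega), zero_smul]
      exact zero_mem _

theorem lower_word_mem_filt (w : List ℕ) (hw : ∀ i ∈ w, 1 ≤ i) (j : ℕ) :
    S.lower j (S.word w) ∈ S.filt (w.sum - j) := by
  induction w generalizing j with
  | nil => simp
  | cons i w ih =>
    have hi : 1 ≤ i := hw i (by simp)
    have hw' : ∀ i ∈ w, 1 ≤ i := fun a ha => hw a (by simp [ha])
    have hx : S.word w ∈ S.filt w.sum := S.word_mem_filt hw' le_rfl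
    have h1 : S.mode (S.s - i) (S.lower j (S.word w)) ∈ S.filt ((i :: w).sum - j) :=
      S.filt_mono (by push_cast [List.sum_cons]; omega) (S.raise_mem_filt hi (ih hw' j))
    have h2 : S.mode (S.s + (S.s + j - i)) (S.word w) ∈ S.filt ((w.sum : ℤ) + (i - j)) :=
      S.mode_mem_filt_of_lower hx (ih hw') _ _ (by omega) (by omega)
    rw [word_cons, lower_apply, S.comm]
    have h3 : S.mode (S.s - i) (S.mode ((S.s + j : ℕ) : ℤ) (S.word w)) =
        S.mode (S.s - i) (S.lower j (S.word w)) +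
          S.eig (S.s + j) • S.mode (S.s - i) (S.word w) := by
      rw [mode_eq_lower_add, map_add, map_smul]
    rw [h3, add_right_comm _ (S.eig _ • _), add_right_comm _ (S.eig _ • _), add_sub_cancel_right]
    refine add_mem (add_mem h1 (Submodule.smul_mem _ _ ?_)) ?_
    · have e : ((S.s + j : ℕ) : ℤ) + (S.s - i) = S.s + (S.s + j - i) := by push_cast; ring
      rw [e]
      exact S.filt_mono (by push_cast [List.sum_cons]; omega) h2
    · split_ifs with h
      · exact Submodule.smul_mem _ _ (S.filt_mono (by push_cast [List.sum_cons] at h ⊢; omega) hx)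
      · simp

/-- The operator `L_{s+j} - Λ_{s+j}` lowers the weight by `j`. -/
theorem lower_mem_filt {d : ℤ} {x : V} (hx : x ∈ S.filt d) (j : ℕ) :
    S.lower j x ∈ S.filt (d - j) := by
  induction hx using S.filt_induction with
  | word w hw h => exact S.filt_mono (by omega) (S.lower_word_mem_filt w hw j)
  | zero => simp
  | add x y _ _ hx hy => rw [map_add]; exact add_mem hx hy
  | smul a x _ hx => rw [map_smul]; exact Submodule.smul_mem _ _ hx

/-- The operator `L_{s+k}` raises the weight by at most `e` when `e ≥ -k` and, unless `k > s`, `e ≥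
0`: the eigenvalue of `L_{s+k}` on the irregular vector, which does not lower the weight, vanishes
for `k > s`. -/
theorem mode_mem_filt {d : ℤ} {x : V} (hx : x ∈ S.filt d) (k e : ℤ) (hke : -k ≤ e)
    (he : k ≤ S.s → 0 ≤ e) : S.mode (S.s + k) x ∈ S.filt (d + e) :=
  S.mode_mem_filt_of_lower hx (S.lower_mem_filt hx) k e hke he

/-- `Σ_{j=1}^N L_{s-j} (L_{s+j} - Λ_{s+j})`: on the associated graded module, this is a multiple
of the Euler operator. -/
def euler (N : ℕ) : Module.End K V :=
  ∑ j ∈ Finset.Icc 1 N, S.mode (S.s - j) * S.lower j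

theorem euler_apply (N : ℕ) (x : V) :
    S.euler N x = ∑ j ∈ Finset.Icc 1 N, S.mode (S.s - j) (S.lower j x) := by
  simp [euler, LinearMap.sum_apply]

theorem lower_comm_mode (j : ℕ) (n : ℤ) (x : V) :
    S.lower j (S.mode n x) = S.mode n (S.lower j x) +
      (((S.s + j : ℕ) - n : ℤ) : K) • S.mode ((S.s + j : ℕ) + n) x +
      (if ((S.s + j : ℕ) : ℤ) + n = 0 then
        algebraMap ℚ K (((((S.s + j : ℕ) : ℤ) : ℚ) ^ 3 - ((S.s + j : ℕ) : ℤ)) / 12) * S.charge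
        else 0) • x := by
  rw [lower_apply, S.comm, lower_apply, map_sub, map_smul]
  abel

theorem euler_mem_filt {d : ℤ} {x : V} (hx : x ∈ S.filt d) (N : ℕ) :
    S.euler N x ∈ S.filt d := by
  rw [euler_apply]
  refine sum_mem fun j hj => ?_
  rw [Finset.mem_Icc] at hj
  exact S.filt_mono (by omega) (S.raise_mem_filt hj.1 (S.lower_mem_filt hx j))

theorem euler_word (w : List ℕ) (hw : ∀ i ∈ w, 1 ≤ i) (N : ℕ) (hN : w.sum ≤ N) :
    S.euler N (S.word w) + (2 * S.κ * (w.sum : K)) • S.word w ∈ S.filt (w.sum - 1) := by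
  induction w with
  | nil => simp [euler_apply]
  | cons i w ih =>
    have hi : 1 ≤ i := hw i (by simp)
    have hw' : ∀ i ∈ w, 1 ≤ i := fun a ha => hw a (by simp [ha])
    have hx : S.word w ∈ S.filt w.sum := S.word_mem_filt hw' le_rfl
    rw [List.sum_cons] at hN
    have ih := ih hw' (by omega)
    set x := S.word w with hxdef
    -- each summand, up to terms of lower weight and the diagonal contribution at `j = i`
    have key : ∀ j ∈ Finset.Icc 1 N, S.mode (S.s - j) (S.lower j (S.mode (S.s - i) x)) -
        S.mode (S.s - i) (S.mode (S.s - j) (S.lower j x)) +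
        (if j = i then (2 * S.κ * (i : K)) • S.mode (S.s - i) x else 0) ∈
          S.filt (((i :: w).sum : ℕ) - 1 : ℤ) := by
      intro j hj
      rw [Finset.mem_Icc] at hj
      have hTx : S.lower j x ∈ S.filt (w.sum - j) := S.lower_mem_filt hx j
      rw [lower_comm_mode, map_add, map_add, map_smul, map_smul, S.comm (S.s - j) (S.s - i)]
      have ha : (((S.s + j : ℕ) - (S.s - i) : ℤ) : K) •
          S.mode (S.s - j) (S.mode (((S.s + j : ℕ) : ℤ) + (S.s - i)) x) +
          (if j = i then (2 * S.κ * (i : K)) • S.mode (S.s - i) x else 0) ∈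
          S.filt (((i :: w).sum : ℕ) - 1 : ℤ) := by
        split_ifs with hji
        · subst hji
          have e : ((S.s + j : ℕ) : ℤ) + (S.s - j) = ((S.s + S.s : ℕ) : ℤ) := by push_cast; ring
          rw [e, mode_eq_lower_add, map_add, map_smul, ← two_mul, S.eig_two_mul]
          have e2 : (((S.s + j : ℕ) - (S.s - j) : ℤ) : K) = 2 * (j : K) := by push_cast; ring
          rw [e2, smul_add, smul_smul, add_assoc, ← add_smul]
          have e3 : 2 * (j : K) * -S.κ + 2 * S.κ * (j : K) = 0 := by ring
          rw [e3, zero_smul, add_zero]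
          refine Submodule.smul_mem _ _ (S.filt_mono ?_
            (S.raise_mem_filt hj.1 (S.lower_mem_filt hx S.s)))
          have := S.one_le_s
          push_cast [List.sum_cons]; omega
        · rw [add_zero]
          refine Submodule.smul_mem _ _ ?_
          have e : ((S.s + j : ℕ) : ℤ) + (S.s - i) = S.s + (S.s + j - i) := by push_cast; ring
          rw [e]
          refine S.filt_mono ?_ (S.raise_mem_filt hj.1
            (S.mode_mem_filt hx (S.s + j - i) (i - j - 1 : ℤ) ?_ ?_))
          · push_cast [List.sum_cons]; omega
          · have := S.one_le_s; omega
          · omega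
      have hb : (((S.s - j) - (S.s - i) : ℤ) : K) •
          S.mode ((S.s - j) + (S.s - i)) (S.lower j x) ∈ S.filt (((i :: w).sum : ℕ) - 1 : ℤ) := by
        refine Submodule.smul_mem _ _ ?_
        have e : ((S.s : ℤ) - j) + (S.s - i) = S.s + (S.s - j - i) := by ring
        rw [e]
        have := S.one_le_s
        refine S.filt_mono ?_ (S.mode_mem_filt hTx (S.s - j - i) (i + j - 1 : ℤ) ?_ ?_)
        · push_cast [List.sum_cons]; omega
        · omega
        · omega
      have hc : ∀ a : K, a • S.lower j x ∈ S.filt (((i :: w).sum : ℕ) - 1 : ℤ) := fun a =>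
        Submodule.smul_mem _ _ (S.filt_mono (by push_cast [List.sum_cons]; omega) hTx)
      have hd : (if ((S.s + j : ℕ) : ℤ) + (S.s - i) = 0 then
          algebraMap ℚ K (((((S.s + j : ℕ) : ℤ) : ℚ) ^ 3 - ((S.s + j : ℕ) : ℤ)) / 12) * S.charge
          else 0) • S.mode (S.s - j) x ∈ S.filt (((i :: w).sum : ℕ) - 1 : ℤ) := by
        split_ifs with h
        · exact Submodule.smul_mem _ _ (S.filt_mono (by
            have := S.one_le_s
            push_cast [List.sum_cons] at h ⊢; omega) (S.raise_mem_filt hj.1 hx))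
        · simp
      convert add_mem (add_mem ha (add_mem hb (hc (if ((S.s : ℤ) - j) + (S.s - i) = 0 then
        algebraMap ℚ K (((((S.s : ℤ) - j : ℤ) : ℚ) ^ 3 - ((S.s : ℤ) - j : ℤ)) / 12) * S.charge
        else 0)))) hd using 1
      abel
    have hsum := sum_mem key
    rw [Finset.sum_add_distrib, Finset.sum_sub_distrib, ← map_sum, ← euler_apply, ← euler_apply,
      Finset.sum_ite_eq' (Finset.Icc 1 N), if_pos (Finset.mem_Icc.2 ⟨hi, by omega⟩)] at hsum
    have h2 : S.mode (S.s - i) (S.euler N x + (2 * S.κ * (w.sum : K)) • x) ∈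
        S.filt (((i :: w).sum : ℕ) - 1 : ℤ) :=
      S.filt_mono (by push_cast [List.sum_cons]; omega) (S.raise_mem_filt hi ih)
    rw [map_add, map_smul] at h2
    convert add_mem hsum h2 using 1
    rw [word_cons, ← hxdef, List.sum_cons]
    push_cast
    rw [mul_add, add_smul]
    abel

/-- Modulo lower weight, the Euler operator acts on vectors of weight `d` as `-2 κ d`. -/
theorem euler_add_mem_filt {d N : ℕ} (hN : d ≤ N) {x : V} (hx : x ∈ S.filt d) :
    S.euler N x + (2 * S.κ * (d : K)) • x ∈ S.filt (d - 1) := by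
  induction hx using S.filt_induction with
  | word w hw h =>
    rcases eq_or_lt_of_le h with h | h
    · have h : w.sum = d := by omega
      subst h
      exact S.euler_word w hw N hN
    · have hx : S.word w ∈ S.filt (d - 1) := S.word_mem_filt hw (by omega)
      exact add_mem (S.euler_mem_filt hx N) (Submodule.smul_mem _ _ hx)
  | zero => simp
  | add x y _ _ hx hy =>
    rw [map_add, smul_add, add_add_add_comm]; exact add_mem hx hy
  | smul a x _ hx =>
    rw [map_smul, smul_comm, ← smul_add]; exact Submodule.smul_mem _ _ hx

theorem isUnit_natCast {d : ℕ} (hd : d ≠ 0) : IsUnit (d : K) := by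
  have : IsUnit (algebraMap ℚ K d) := (IsUnit.mk0 (d : ℚ) (by exact_mod_cast hd)).map _
  simpa using this

theorem isUnit_two_mul_κ_mul {d : ℕ} (hd : d ≠ 0) : IsUnit (2 * S.κ * (d : K)) := by
  have h2 : IsUnit (2 : K) := by exact_mod_cast isUnit_natCast (K := K) (two_ne_zero)
  exact (h2.mul S.isUnit_κ).mul (isUnit_natCast hd)

/-- The only vectors of finite weight with the same eigenvalues as the irregular vector for all
`L_n` with `n > s` are the multiples of the irregular vector. -/
theorem exists_eq_smul_vac_of_lower_eq_zero {d : ℕ} {x : V} (hx : x ∈ S.filt d)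
    (h : ∀ j, 1 ≤ j → S.lower j x = 0) : ∃ a : K, x = a • S.vac := by
  induction d with
  | zero => exact S.exists_eq_smul_vac hx
  | succ d ih =>
    have h1 := S.euler_add_mem_filt le_rfl hx
    have h0 : S.euler (d + 1) x = 0 := by
      rw [euler_apply]
      exact Finset.sum_eq_zero fun j hj => by rw [h j (Finset.mem_Icc.1 hj).1, map_zero]
    rw [h0, zero_add] at h1
    have hu := S.isUnit_two_mul_κ_mul (Nat.succ_ne_zero d)
    have h2 : x ∈ S.filt ((d + 1 : ℕ) - 1 : ℤ) :=
      (Submodule.smul_mem_iff_of_isUnit _ hu).1 h1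
    exact ih (S.filt_mono (by push_cast; omega) h2)

/-- The operators `L_{s+j} - Λ_{s+j}` satisfy the same relations as the `L_{s+j}`: since `2 s + j +
k > 2 s`, neither the eigenvalues nor the central term contribute. -/
theorem lower_comm {j k : ℕ} (hjk : 1 ≤ j + k) (x : V) :
    S.lower j (S.lower k x) =
      S.lower k (S.lower j x) + ((j : K) - k) • S.lower (S.s + j + k) x := by
  rw [S.lower_apply k x, map_sub, map_smul, lower_comm_mode, S.lower_apply k, S.lower_apply (_ + _),
    if_neg (by have := S.one_le_s; push_cast; omega), S.eig_of_lt (S.s + (S.s + j + k)) (by omega)]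
  have e : ((S.s + j : ℕ) : ℤ) + (S.s + k : ℕ) = ((S.s + (S.s + j + k) : ℕ) : ℤ) := by
    push_cast; ring
  rw [e]
  push_cast
  simp only [zero_smul, sub_zero, add_zero]
  rw [add_sub_add_left_eq_sub]
  abel

/-- The equations for `s < n ≤ 2 s + 2` imply those for all `n > s`: the remaining `L_n` are
commutators. -/
theorem lower_eq_zero_of_le {x : V} (h : ∀ j, 1 ≤ j → j ≤ S.s + 2 → S.lower j x = 0) {j : ℕ}
    (hj : 1 ≤ j) : S.lower j x = 0 := by
  induction j using Nat.strong_induction_on with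
  | _ j ih =>
    rcases le_or_gt j (S.s + 2) with hle | hgt
    · exact h j hj hle
    · obtain ⟨k, rfl⟩ : ∃ k, j = S.s + (k + 2) + 1 := ⟨j - S.s - 3, by omega⟩
      have hc := S.lower_comm (j := k + 2) (k := 1) (by omega) x
      rw [ih 1 (by omega) le_rfl, ih (k + 2) (by omega) (by omega), map_zero, map_zero,
        zero_add] at hc
      have hu : IsUnit (((k + 2 : ℕ) : K) - (1 : ℕ)) := by
        have : ((k + 2 : ℕ) : K) - (1 : ℕ) = ((k + 1 : ℕ) : K) := by push_cast; ring
        rw [this]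
        exact isUnit_natCast (by omega)
      exact hu.smul_left_cancel.1 (by rw [← hc, smul_zero])

/-- A Poincaré lemma: a cocycle of the Lie algebra spanned by the `L_n` with `n > s`, with
values of finite weight, is a coboundary. -/
theorem exists_lower_eq {d : ℕ} {w : ℕ → V}
    (hw : ∀ j k, 1 ≤ j → 1 ≤ k →
      S.lower j (w k) = S.lower k (w j) + ((j : K) - k) • w (S.s + j + k))
    (hd : ∀ j : ℕ, 1 ≤ j → w j ∈ S.filt (d - j)) :
    ∃ v ∈ S.filt d, ∀ j, 1 ≤ j → S.lower j v = w j := by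
  induction d generalizing w with
  | zero =>
    refine ⟨0, zero_mem _, fun j hj => ?_⟩
    rw [map_zero, S.filt_eq_zero_of_neg (by push_cast; omega) (hd j hj)]
  | succ d ih =>
    obtain ⟨u, hu⟩ := S.isUnit_two_mul_κ_mul (Nat.succ_ne_zero d)
    set y : V := ∑ j ∈ Finset.Icc 1 (d + 1), S.mode (S.s - j) (w j) with hy
    have hyd : y ∈ S.filt ((d + 1 : ℕ) : ℤ) := sum_mem fun j hj =>
      S.filt_mono (by omega) (S.raise_mem_filt (Finset.mem_Icc.1 hj).1
        (hd j (Finset.mem_Icc.1 hj).1))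
    -- the leading part of the primitive is a radial integral
    have hlead : ∀ k : ℕ, 1 ≤ k → S.lower k y + (u : K) • w k ∈ S.filt (d - k) := by
      intro k hk
      rcases le_or_gt k (d + 1) with hkd | hkd
      swap
      · have h1 : S.lower k y = 0 := S.filt_eq_zero_of_neg (by omega) (S.lower_mem_filt hyd k)
        have h2 : w k = 0 := S.filt_eq_zero_of_neg (by omega) (hd k hk)
        rw [h1, h2]; simp
      have hwk := hd k hk
      have key : ∀ j ∈ Finset.Icc 1 (d + 1), S.lower k (S.mode (S.s - j) (w j)) -
          S.mode (S.s - j) (S.lower j (w k)) +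
          (if j = k then (2 * S.κ * (k : K)) • w k else 0) ∈ S.filt (d - k) := by
        intro j hj
        rw [Finset.mem_Icc] at hj
        have hwj := hd j hj.1
        rw [lower_comm_mode, hw k j hk hj.1, map_add, map_smul]
        have ha : ((k : K) - j) • S.mode (S.s - j) (w (S.s + k + j)) ∈ S.filt (d - k) := by
          refine Submodule.smul_mem _ _ (S.filt_mono ?_
            (S.raise_mem_filt hj.1 (hd (S.s + k + j) (by omega))))
          have := S.one_le_s
          push_cast; omega
        have hc : (if ((S.s + k : ℕ) : ℤ) + (S.s - j) = 0 then
            algebraMap ℚ K (((((S.s + k : ℕ) : ℤ) : ℚ) ^ 3 - ((S.s + k : ℕ) : ℤ)) / 12) * S.charge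
            else 0) • w j ∈ S.filt (d - k) := by
          split_ifs with h
          · refine Submodule.smul_mem _ _ (S.filt_mono ?_ hwj)
            have := S.one_le_s
            push_cast at h ⊢; omega
          · simp
        have hb : (((S.s + k : ℕ) - (S.s - j) : ℤ) : K) •
            S.mode (((S.s + k : ℕ) : ℤ) + (S.s - j)) (w j) +
            (if j = k then (2 * S.κ * (k : K)) • w k else 0) ∈ S.filt (d - k) := by
          split_ifs with hjk
          · subst hjk
            have e : ((S.s + j : ℕ) : ℤ) + (S.s - j) = ((S.s + S.s : ℕ) : ℤ) := by
              push_cast; ring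
            have e2 : (((S.s + j : ℕ) - (S.s - j) : ℤ) : K) = 2 * (j : K) := by push_cast; ring
            rw [e, mode_eq_lower_add, ← two_mul, S.eig_two_mul, e2, smul_add, smul_smul,
              add_assoc, ← add_smul]
            have e3 : 2 * (j : K) * -S.κ + 2 * S.κ * (j : K) = 0 := by ring
            rw [e3, zero_smul, add_zero]
            refine Submodule.smul_mem _ _ (S.filt_mono ?_ (S.lower_mem_filt hwj S.s))
            have := S.one_le_s
            push_cast; omega
          · rw [add_zero]
            refine Submodule.smul_mem _ _ ?_
            have e : ((S.s + k : ℕ) : ℤ) + (S.s - j) = S.s + (S.s + k - j) := by push_cast; ring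
            rw [e]
            refine S.filt_mono ?_ (S.mode_mem_filt hwj (S.s + k - j) (j - k - 1 : ℤ) ?_ ?_)
            · push_cast; omega
            · have := S.one_le_s; omega
            · omega
        convert add_mem (add_mem hb hc) ha using 1
        abel
      have hsum := sum_mem key
      rw [Finset.sum_add_distrib, Finset.sum_sub_distrib, ← map_sum, ← hy, ← euler_apply,
        Finset.sum_ite_eq' (Finset.Icc 1 (d + 1)), if_pos (Finset.mem_Icc.2 ⟨hk, hkd⟩)] at hsum
      have hwk' : w k ∈ S.filt ((d + 1 - k : ℕ) : ℤ) := S.filt_mono (by omega) hwk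
      have he := S.euler_add_mem_filt (N := d + 1) (by omega) hwk'
      convert add_mem hsum (S.filt_mono (by omega) he) using 1
      have e4 : (u : K) = 2 * S.κ * (k : K) + 2 * S.κ * ((d + 1 - k : ℕ) : K) := by
        rw [hu, ← mul_add, ← Nat.cast_add]
        congr 3
        omega
      rw [e4, add_smul]
      abel
    -- correct the leading part by a primitive of the remainder
    obtain ⟨v, hv, hvw⟩ := ih (w := fun k => w k + (↑u⁻¹ : K) • S.lower k y)
      (fun j k hj hk => by
        simp only [map_add, map_smul]
        rw [hw j k hj hk, S.lower_comm (by omega)]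
        simp only [smul_add, smul_comm _ ((j : K) - k)]
        abel)
      (fun j hj => by
        have : w j + (↑u⁻¹ : K) • S.lower j y = (↑u⁻¹ : K) • (S.lower j y + (u : K) • w j) := by
          rw [smul_add, smul_smul, Units.inv_mul, one_smul, add_comm]
        rw [this]
        exact Submodule.smul_mem _ _ (hlead j hj))
    refine ⟨v - (↑u⁻¹ : K) • y, sub_mem (S.filt_mono (by push_cast; omega) hv)
      (Submodule.smul_mem _ _ hyd), fun j hj => ?_⟩
    rw [map_sub, map_smul, hvw j hj]
    abel

end IrregularModes

/-! ### Deformations of the irregular vector -/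

namespace IrregularModes

variable {K V : Type*} [CommRing K] [Algebra ℚ K] [AddCommGroup V] [Module K V]
  (S : IrregularModes K V)

/-- If the irregular vector generates, then every vector has finite weight. -/
theorem exists_mem_filt
    (hgen : ∀ N : Submodule K V, S.vac ∈ N → (∀ n, ∀ x ∈ N, S.mode n x ∈ N) → N = ⊤) (x : V) :
    ∃ d : ℕ, x ∈ S.filt d := by
  let N : Submodule K V :=
    { carrier := {x | ∃ d : ℕ, x ∈ S.filt d}
      zero_mem' := ⟨0, zero_mem _⟩
      add_mem' := by
        rintro a b ⟨d, hd⟩ ⟨e, he⟩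
        exact ⟨d + e, add_mem (S.filt_mono (by omega) hd) (S.filt_mono (by omega) he)⟩
      smul_mem' := fun a x ⟨d, hd⟩ => ⟨d, Submodule.smul_mem _ _ hd⟩ }
  have hN : N = ⊤ := hgen N ⟨0, S.vac_mem_filt⟩ fun n x ⟨d, hd⟩ => by
    refine ⟨d + (n - S.s).natAbs, ?_⟩
    have := S.mode_mem_filt hd (n - S.s) (n - S.s).natAbs (by omega) (by omega)
    rwa [add_sub_cancel, ← Nat.cast_add] at this
  have : x ∈ N := hN ▸ Submodule.mem_top
  exact this

/-- A vector with the eigenvalues of the irregular vector and without constant term vanishes. -/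
theorem eq_zero_of_lower_eq_zero (hfin : ∀ x, ∃ d : ℕ, x ∈ S.filt d)
    (ε : V →ₗ[K] K) (hε : ε S.vac = 1) {x : V}
    (h : ∀ j, 1 ≤ j → j ≤ S.s + 2 → S.lower j x = 0)
    (hx : ε x = 0) : x = 0 := by
  obtain ⟨d, hd⟩ := hfin x
  obtain ⟨a, rfl⟩ :=
    S.exists_eq_smul_vac_of_lower_eq_zero hd fun j hj => S.lower_eq_zero_of_le h hj
  rw [map_smul, hε, smul_eq_mul, mul_one] at hx
  rw [hx, zero_smul]

/-- The coefficients of a deformation of the irregular vector with eigenvalues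
`Λ_{s+j} + t μ_j + t² ρ_j` exist, with vanishing constant terms in positive degree.  The functional
`ε` is the constant term. -/
theorem exists_deformation (hfin : ∀ x, ∃ d : ℕ, x ∈ S.filt d)
    (ε : V →ₗ[K] K) (hε : ε S.vac = 1)
    (μ ρ : ℕ → K) (hμ : ∀ j, S.s + 2 < j → μ j = 0) (hρ : ∀ j, S.s + 2 < j → ρ j = 0) :
    ∃ v : ℕ → V, v 0 = S.vac ∧ (∀ m, ε (v (m + 1)) = 0) ∧
      ∀ j, 1 ≤ j → S.lower j (v 0) = 0 ∧ S.lower j (v 1) = μ j • v 0 ∧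
        ∀ m, S.lower j (v (m + 2)) = μ j • v (m + 1) + ρ j • v m := by
  -- four consecutive coefficients, of which the first two satisfy their equations
  let Q := {q : V × V × V × V // ∀ j, 1 ≤ j →
    S.lower j q.1 = μ j • q.2.1 + ρ j • q.2.2.1 ∧
    S.lower j q.2.1 = μ j • q.2.2.1 + ρ j • q.2.2.2}
  have step : ∀ q : Q, ∃ q' : Q, q'.1.2 = (q.1.1, q.1.2.1, q.1.2.2.1) ∧ ε q'.1.1 = 0 := by
    rintro ⟨⟨a, b, c, d⟩, hq⟩
    obtain ⟨d₁, h₁⟩ := hfin a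
    obtain ⟨d₂, h₂⟩ := hfin b
    obtain ⟨x, -, hx⟩ := S.exists_lower_eq (d := d₁ + d₂ + S.s + 2)
      (w := fun j => μ j • a + ρ j • b)
      (fun j k hj hk => by
        have h0 : ((j : K) - k) • (μ (S.s + j + k) • a + ρ (S.s + j + k) • b) = 0 := by
          rcases eq_or_ne j k with rfl | hjk
          · simp
          · rw [hμ _ (by omega), hρ _ (by omega)]; simp
        simp only [map_add, map_smul, h0, (hq j hj).1, (hq j hj).2, (hq k hk).1, (hq k hk).2]
        module)
      (fun j hj => by
        rcases le_or_gt j (S.s + 2) with hle | hgt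
        · exact add_mem (Submodule.smul_mem _ _ (S.filt_mono (by push_cast; omega) h₁))
            (Submodule.smul_mem _ _ (S.filt_mono (by push_cast; omega) h₂))
        · simp [hμ _ hgt, hρ _ hgt])
    refine ⟨⟨(x - ε x • S.vac, a, b, c), fun j hj => ⟨?_, (hq j hj).1⟩⟩, rfl, ?_⟩
    · simp [hx j hj]
    · simp [hε]
  choose next hnext hεnext using step
  let q₀ : Q := ⟨(S.vac, 0, 0, 0), fun j _ => by simp⟩
  let q : ℕ → Q := fun m => next^[m] q₀
  have hq : ∀ m, q (m + 1) = next (q m) := fun m => Function.iterate_succ_apply' _ _ _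
  have h1 : ∀ m, (q (m + 1)).1.2.1 = (q m).1.1 := fun m => by rw [hq, hnext]
  have h2 : ∀ m, (q (m + 2)).1.2.2.1 = (q m).1.1 := fun m => by rw [hq, hnext, h1]
  refine ⟨fun m => (q m).1.1, rfl, fun m => by
    beta_reduce; rw [hq]; exact hεnext _, fun j hj => ⟨?_, ?_, ?_⟩⟩
  · exact S.lower_vac j
  · have := ((q 1).2 j hj).1
    rw [h1] at this
    rw [this, hq, hnext]
    simp [q, q₀]
  · intro m
    have := ((q (m + 2)).2 j hj).1
    rwa [h1, h2] at this

end IrregularModes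

/-! ### Sorting words in the Virasoro generators -/

namespace VirasoroWord

/-- The number of inversions of a word. -/
def inv : List ℤ → ℕ
  | [] => 0
  | x :: w => w.countP (· < x) + inv w

theorem inv_swap (a : List ℤ) {m n : ℤ} (h : n < m) (b : List ℤ) :
    inv (a ++ n :: m :: b) < inv (a ++ m :: n :: b) := by
  induction a with
  | nil =>
    have h' : ¬ m < n := by omega
    simp only [List.nil_append, inv, List.countP_cons, h, h', decide_true, decide_false, if_true]
    simp
    omega
  | cons x a ih =>
    have hp : (a ++ n :: m :: b).Perm (a ++ m :: n :: b) :=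
      List.Perm.append_left _ (List.Perm.swap _ _ _)
    simp only [List.cons_append, inv, hp.countP_eq]
    omega

/-- `HasDescent w q`: the word `w` is `q.1 m n q.2.2.2` with `m = q.2.1 > n = q.2.2.1`. -/
def HasDescent (w : List ℤ) (q : List ℤ × ℤ × ℤ × List ℤ) : Prop :=
  w = q.1 ++ q.2.1 :: q.2.2.1 :: q.2.2.2 ∧ q.2.2.1 < q.2.1

/-- Induction on the length of a word, then on the number of its inversions. -/
theorem strong_induction {p : List ℤ → Prop}
    (h : ∀ w, (∀ u, u.length < w.length → p u) →
      (∀ u, u.length = w.length → inv u < inv w → p u) → p w) (w : List ℤ) : p w := by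
  generalize hl : w.length = l
  induction l using Nat.strong_induction_on generalizing w with
  | _ l ihl =>
    generalize hi : inv w = i
    induction i using Nat.strong_induction_on generalizing w with
    | _ i ihi =>
      exact h w (fun u hu => ihl _ (hl ▸ hu) u rfl)
        fun u hu hv => ihi _ (hi ▸ hv) u (hu.trans hl) rfl

/-- Induction along the sorting of a word: exchanging the two letters of a descent removes an
inversion, and the commutator terms are shorter words. -/
theorem descent_induction {p : List ℤ → Prop}
    (sorted : ∀ w, (∀ u, u.length < w.length → p u) → (¬∃ q, HasDescent w q) → p w)
    (step : ∀ a m n b, n < m → (∀ u, u.length < (a ++ m :: n :: b).length → p u) →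
      p (a ++ n :: m :: b) → p (a ++ m :: n :: b)) (w : List ℤ) : p w := by
  induction w using strong_induction with
  | h w h1 h2 =>
    by_cases hw : ∃ q, HasDescent w q
    · obtain ⟨⟨a, m, n, b⟩, rfl, hlt⟩ := hw
      exact step a m n b hlt h1 (h2 _ (by simp) (inv_swap a hlt b))
    · exact sorted w h1 hw

theorem pairwise_of_not_hasDescent {w : List ℤ} (h : ¬∃ q, HasDescent w q) :
    w.Pairwise (· ≤ ·) := by
  rw [← List.isChain_iff_pairwise, List.isChain_iff_forall_rel_of_append_cons_cons]
  intro m n a b hw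
  by_contra hlt
  exact h ⟨(a, m, n, b), hw, not_le.1 hlt⟩

theorem not_hasDescent_of_pairwise {w : List ℤ} (h : w.Pairwise (· ≤ ·)) :
    ¬∃ q, HasDescent w q := by
  rintro ⟨⟨a, m, n, b⟩, rfl, hlt⟩
  rw [← List.isChain_iff_pairwise, List.isChain_iff_forall_rel_of_append_cons_cons] at h
  exact absurd (h rfl) (not_le.2 hlt)

variable {K : Type*} [CommRing K] [Algebra ℚ K]

/-- The central term of `[L_m, L_n]` at central charge `cc`. -/
noncomputable def cocycle (cc : K) (m n : ℤ) : K :=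
  if m + n = 0 then algebraMap ℚ K (((m : ℚ) ^ 3 - m) / 12) * cc else 0

theorem cocycle_antisymm (cc : K) (m n : ℤ) : cocycle cc n m = -cocycle cc m n := by
  unfold cocycle
  rw [add_comm n m]
  split_ifs with h
  · obtain rfl : n = -m := by omega
    rw [← neg_mul, ← map_neg]
    congr 2
    push_cast; ring
  · simp

theorem cocycle_self (cc : K) (m : ℤ) : cocycle cc m m = 0 := by
  unfold cocycle
  split_ifs with h
  · obtain rfl : m = 0 := by omega
    simp
  · rfl

theorem cocycle_jacobi (cc : K) (m n q : ℤ) :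
    ((m : K) - n) * cocycle cc (m + n) q + ((m : K) - q) * cocycle cc n (m + q) +
      ((n : K) - q) * cocycle cc (n + q) m = 0 := by
  unfold cocycle
  have e1 : n + (m + q) = m + n + q := by ring
  have e2 : n + q + m = m + n + q := by ring
  rw [e1, e2]
  split_ifs with h
  · obtain rfl : q = -(m + n) := by omega
    have hc : ∀ z : ℤ, (z : K) = algebraMap ℚ K (z : ℚ) := fun z => by simp
    simp only [hc, ← mul_assoc, ← map_sub, ← map_mul, ← add_mul, ← map_add]
    convert zero_mul cc
    rw [← map_zero (algebraMap ℚ K)]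
    congr 1
    push_cast; ring
  · simp

variable (cc : K) (s : ℕ) (χ : ℤ → K)

/-- The value of `φ` on `a L_m L_n b` as prescribed by the Virasoro relation. -/
noncomputable def swapped (φ : List ℤ → K) (a : List ℤ) (m n : ℤ) (b : List ℤ) : K :=
  φ (a ++ n :: m :: b) + ((m : K) - n) * φ (a ++ (m + n) :: b) + cocycle cc m n * φ (a ++ b)

open Classical in
/-- The constant term of a word in the `L_n` applied to the irregular vector with eigenvalues
`χ n` for `n ≥ s`: the word is sorted with the help of the Virasoro relations; a sorted word
contributes when all its letters are at least `s`. -/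
noncomputable def constTerm (w : List ℤ) : K :=
  if h : ∃ q, HasDescent w q then
    constTerm (h.choose.1 ++ h.choose.2.2.1 :: h.choose.2.1 :: h.choose.2.2.2) +
      ((h.choose.2.1 : K) - h.choose.2.2.1) *
        constTerm (h.choose.1 ++ (h.choose.2.1 + h.choose.2.2.1) :: h.choose.2.2.2) +
      cocycle cc h.choose.2.1 h.choose.2.2.1 * constTerm (h.choose.1 ++ h.choose.2.2.2)
  else if ∀ x ∈ w, (s : ℤ) ≤ x then (w.map χ).prod else 0
termination_by (w.length, inv w)
decreasing_by
  all_goals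
    have hw : w.length = (h.choose.1 ++ h.choose.2.1 :: h.choose.2.2.1 :: h.choose.2.2.2).length :=
      congrArg List.length h.choose_spec.1
    have hi : inv w = inv (h.choose.1 ++ h.choose.2.1 :: h.choose.2.2.1 :: h.choose.2.2.2) :=
      congrArg inv h.choose_spec.1
    have hs := inv_swap h.choose.1 h.choose_spec.2 h.choose.2.2.2
    simp only [List.length_append, List.length_cons] at hw
    simp only [Prod.lex_def, List.length_append, List.length_cons]
    omega

theorem constTerm_of_hasDescent {w : List ℤ} (h : ∃ q, HasDescent w q) :
    constTerm cc s χ w = swapped cc (constTerm cc s χ) h.choose.1 h.choose.2.1 h.choose.2.2.1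
      h.choose.2.2.2 := by
  rw [constTerm, dif_pos h, swapped]

open Classical in
theorem constTerm_of_not_hasDescent {w : List ℤ} (h : ¬∃ q, HasDescent w q) :
    constTerm cc s χ w = if ∀ x ∈ w, (s : ℤ) ≤ x then (w.map χ).prod else 0 := by
  rw [constTerm, dif_neg h]

theorem swapped_symm {φ : List ℤ → K} {a : List ℤ} {m n : ℤ} {b : List ℤ}
    (h : φ (a ++ m :: n :: b) = swapped cc φ a m n b) :
    φ (a ++ n :: m :: b) = swapped cc φ a n m b := by
  unfold swapped at *
  rw [h, cocycle_antisymm cc m n, add_comm n m]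
  ring

theorem eq_swapped_self (φ : List ℤ → K) (a : List ℤ) (m : ℤ) (b : List ℤ) :
    φ (a ++ m :: m :: b) = swapped cc φ a m m b := by
  simp [swapped, cocycle_self]

/-- Confluence: the values obtained from two different descents agree. -/
theorem swapped_eq_swapped_of_append {φ : List ℤ → K} {a c : List ℤ} {m n m' n' : ℤ}
    {b b' : List ℤ} (hlt : n < m) (hlt' : n' < m')
    (hw : m :: n :: b = c ++ m' :: n' :: b')
    (h1 : ∀ a₁ m₁ n₁ b₁, (a₁ ++ m₁ :: n₁ :: b₁).length < (a ++ m :: n :: b).length →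
      φ (a₁ ++ m₁ :: n₁ :: b₁) = swapped cc φ a₁ m₁ n₁ b₁)
    (h2 : ∀ a₁ m₁ n₁ b₁, n₁ < m₁ → (a₁ ++ m₁ :: n₁ :: b₁).length = (a ++ m :: n :: b).length →
      inv (a₁ ++ m₁ :: n₁ :: b₁) < inv (a ++ m :: n :: b) →
      φ (a₁ ++ m₁ :: n₁ :: b₁) = swapped cc φ a₁ m₁ n₁ b₁) :
    swapped cc φ a m n b = swapped cc φ (a ++ c) m' n' b' := by
  match c, hw with
  | [], hw =>
    simp only [List.nil_append, List.cons.injEq] at hw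
    obtain ⟨rfl, rfl, rfl⟩ := hw
    simp
  | [x], hw =>
    -- overlapping descents `m > n > q`: this is the Jacobi identity
    simp only [List.cons_append, List.nil_append, List.cons.injEq] at hw
    obtain ⟨rfl, rfl, rfl⟩ := hw
    have i1 : inv (a ++ n :: m :: n' :: b') < inv (a ++ m :: n :: n' :: b') :=
      inv_swap a hlt (n' :: b')
    have i1' : inv (a ++ [n] ++ n' :: m :: b') < inv (a ++ [n] ++ m :: n' :: b') :=
      inv_swap (a ++ [n]) (hlt'.trans hlt) b'
    have i2 : inv (a ++ [m] ++ n' :: n :: b') < inv (a ++ [m] ++ n :: n' :: b') :=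
      inv_swap (a ++ [m]) hlt' b'
    have i2' : inv (a ++ n' :: m :: n :: b') < inv (a ++ m :: n' :: n :: b') :=
      inv_swap a (hlt'.trans hlt) (n :: b')
    simp only [List.append_assoc, List.cons_append, List.nil_append] at i1' i2
    have r1 := h2 (a ++ [n]) m n' b' (hlt'.trans hlt) (by simp) (by simpa using i1)
    have r2 := h2 a n n' (m :: b') hlt' (by simp) (i1'.trans i1)
    have r3 := h2 a m n' (n :: b') (hlt'.trans hlt) (by simp) i2
    have r4 := h2 (a ++ [n']) m n b' hlt (by simp) (by simpa using i2'.trans i2)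
    have j1 := h1 a (m + n) n' b' (by simp)
    have j2 := h1 a n (m + n') b' (by simp)
    have j3 := h1 a (n + n') m b' (by simp)
    have hz := cocycle_jacobi cc m n n'
    have e2 : n + (m + n') = m + n + n' := by ring
    have e3 : n + n' + m = m + n + n' := by ring
    rw [swapped] at j1 j2 j3
    rw [e2] at j2
    rw [e3] at j3
    simp only [swapped, List.append_assoc, List.cons_append, List.nil_append] at *
    push_cast at *
    rw [r1, r2, r3, r4]
    linear_combination ((m : K) - n) * j1 + ((m : K) - n') * j2 + ((n : K) - n') * j3 +
      φ (a ++ b') * hz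
  | x :: y :: c, hw =>
    -- disjoint descents
    simp only [List.cons_append, List.cons.injEq] at hw
    obtain ⟨rfl, rfl, rfl⟩ := hw
    have i1 := inv_swap a hlt (c ++ m' :: n' :: b')
    have i2 := inv_swap (a ++ m :: n :: c) hlt' b'
    simp only [List.append_assoc, List.cons_append] at i2
    have r1 := h2 (a ++ n :: m :: c) m' n' b' hlt' (by simp) (by simpa using i1)
    have r2 := h1 (a ++ (m + n) :: c) m' n' b' (by simp)
    have r3 := h1 (a ++ c) m' n' b' (by simp)
    have r4 := h2 a m n (c ++ n' :: m' :: b') hlt (by simp) i2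
    have r5 := h1 a m n (c ++ (m' + n') :: b') (by simp)
    have r6 := h1 a m n (c ++ b') (by simp)
    simp only [swapped, List.append_assoc, List.cons_append] at *
    rw [r1, r2, r3, r4, r5, r6]
    ring

/-- The constant term satisfies the Virasoro relations. -/
theorem constTerm_eq_swapped (a : List ℤ) (m n : ℤ) (b : List ℤ) :
    constTerm cc s χ (a ++ m :: n :: b) = swapped cc (constTerm cc s χ) a m n b := by
  suffices H : ∀ w a m n b, w = a ++ m :: n :: b → n < m →
      constTerm cc s χ w = swapped cc (constTerm cc s χ) a m n b by
    rcases lt_trichotomy n m with h | rfl | h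
    · exact H _ a m n b rfl h
    · exact eq_swapped_self cc _ a n b
    · exact swapped_symm cc (H _ a n m b rfl h)
  intro w
  induction w using strong_induction with
  | h w ih1 ih2 =>
    intro a m n b hw hlt
    have hd : ∃ q, HasDescent w q := ⟨(a, m, n, b), hw, hlt⟩
    rw [constTerm_of_hasDescent cc s χ hd]
    obtain ⟨hw', hlt'⟩ := hd.choose_spec
    generalize hd.choose = q at *
    obtain ⟨a', m', n', b'⟩ := q
    dsimp only at *
    have h1 : ∀ a₁ m₁ n₁ b₁, (a₁ ++ m₁ :: n₁ :: b₁).length < w.length →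
        constTerm cc s χ (a₁ ++ m₁ :: n₁ :: b₁) =
          swapped cc (constTerm cc s χ) a₁ m₁ n₁ b₁ := by
      intro a₁ m₁ n₁ b₁ hl
      rcases lt_trichotomy n₁ m₁ with h | rfl | h
      · exact ih1 _ hl a₁ m₁ n₁ b₁ rfl h
      · exact eq_swapped_self cc _ a₁ n₁ b₁
      · exact swapped_symm cc (ih1 _ (by simpa using hl) a₁ n₁ m₁ b₁ rfl h)
    have h2 := fun a₁ m₁ n₁ b₁ (h : n₁ < m₁) hl hi =>
      ih2 (a₁ ++ m₁ :: n₁ :: b₁) hl hi a₁ m₁ n₁ b₁ rfl h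
    rcases List.append_eq_append_iff.1 (hw'.symm.trans hw) with ⟨c, rfl, hc⟩ | ⟨c, rfl, hc⟩
    · rw [hw'] at h1 h2
      exact swapped_eq_swapped_of_append cc hlt' hlt hc h1 h2
    · rw [hw] at h1 h2
      exact (swapped_eq_swapped_of_append cc hlt hlt' hc h1 h2).symm

/-- The last letter of a word acts on the irregular vector by its eigenvalue. -/
theorem constTerm_append (hs : 1 ≤ s) (hχ : ∀ n : ℤ, 2 * s < n → χ n = 0) (w : List ℤ) {n : ℤ}
    (hn : s ≤ n) : constTerm cc s χ (w ++ [n]) = χ n * constTerm cc s χ w := by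
  suffices H : ∀ u w n, u = w ++ [n] → (s : ℤ) ≤ n →
      constTerm cc s χ u = χ n * constTerm cc s χ w from H _ w n rfl hn
  intro u
  induction u using descent_induction with
  | sorted u _ hu =>
    rintro w n rfl hn
    have hw : ¬∃ q, HasDescent w q := by
      rintro ⟨⟨a, m, k, b⟩, rfl, hlt⟩
      exact hu ⟨(a, m, k, b ++ [n]), by simp, hlt⟩
    classical
    rw [constTerm_of_not_hasDescent _ _ _ hu, constTerm_of_not_hasDescent _ _ _ hw]
    simp [List.mem_append, or_imp, forall_and, hn, mul_comm]
  | step a m k b hlt ih1 ih2 =>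
    intro w n hu hn
    rw [constTerm_eq_swapped, swapped]
    rcases List.eq_nil_or_concat b with rfl | ⟨b', x, rfl⟩
    · have e : a ++ [m, k] = (a ++ [m]) ++ [k] := by simp
      rw [e] at hu
      obtain ⟨rfl, hk⟩ := List.append_inj' hu rfl
      obtain rfl : k = n := by simpa using hk
      rw [ih2 (a ++ [k]) m (by simp) (by omega), ih1 (a ++ [m + k]) (by simp) a _ rfl (by omega),
        hχ (m + k) (by omega), ih1 (a ++ [k]) (by simp) a k rfl hn,
        ih1 (a ++ [m]) (by simp) a m rfl (by omega), cocycle, if_neg (by omega)]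
      ring
    · have e : a ++ m :: k :: (b' ++ [x]) = (a ++ m :: k :: b') ++ [x] := by simp
      rw [List.concat_eq_append] at *
      rw [e] at hu
      obtain ⟨rfl, hk⟩ := List.append_inj' hu rfl
      obtain rfl : x = n := by simpa using hk
      rw [ih2 (a ++ k :: m :: b') x (by simp) hn,
        ih1 (a ++ (m + k) :: (b' ++ [x])) (by simp) (a ++ (m + k) :: b') x (by simp) hn,
        ih1 (a ++ (b' ++ [x])) (by simp) (a ++ b') x (by simp) hn,
        constTerm_eq_swapped cc s χ a m k b', swapped]
      ring

end VirasoroWord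

/-! ### The irregular Verma module and its constant terms -/

namespace Virasoro

attribute [local instance] LieRing.ofAssociativeRing

variable {K V : Type*} [CommRing K] [Algebra ℚ K] [AddCommGroup V] [Module K V]

/-- Operators satisfying the Virasoro relations at central charge `cc` define a representation of
the Virasoro algebra. -/
noncomputable def repOfModes (ℓ : ℤ → Module.End K V) (cc : K)
    (h : ∀ m n, ⁅ℓ m, ℓ n⁆ = ((m - n : ℤ) : K) • ℓ (m + n) +
      VirasoroWord.cocycle cc m n • (1 : Module.End K V)) :
    Virasoro K →ₗ⁅K⁆ Module.End K V where
  toFun x := Finsupp.linearCombination K ℓ (proj K x) + (x.2 * cc) • (1 : Module.End K V)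
  map_add' x y := by
    have : (x + y).2 = x.2 + y.2 := rfl
    rw [this, map_add, map_add, add_mul, add_smul]
    abel
  map_smul' a x := by
    have : (a • x).2 = a * x.2 := rfl
    rw [this, map_smul, map_smul, RingHom.id_apply, smul_add, smul_smul, mul_assoc]
  map_lie' {x y} := by
    have key : ∀ f g : ℤ →₀ K,
        Finsupp.linearCombination K ℓ (proj K (bracketAux K f g)) +
          ((bracketAux K f g).2 * cc) • (1 : Module.End K V) =
        ⁅Finsupp.linearCombination K ℓ f, Finsupp.linearCombination K ℓ g⁆ := by
      intro f g
      have h2 : ∀ u v : Virasoro K, (u + v).2 = u.2 + v.2 := fun _ _ => rfl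
      induction f using Finsupp.induction_linear with
      | zero => 
        simp only [map_zero, LinearMap.zero_apply, zero_lie, zero_add]
        have : (0 : Virasoro K).2 = 0 := rfl
        simp [this]
      | add f f' hf hf' =>
        rw [map_add, LinearMap.add_apply, map_add, map_add, map_add, add_lie, ← hf, ← hf', h2,
          add_mul, add_smul]
        abel
      | single m a =>
        induction g using Finsupp.induction_linear with
        | zero =>
          simp only [map_zero, lie_zero, zero_add]
          have : (0 : Virasoro K).2 = 0 := rfl
          simp [this]
        | add g g' hg hg' =>
          rw [map_add, map_add, map_add, map_add, lie_add, ← hg, ← hg', h2, add_mul, add_smul]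
          abel
        | single n b =>
          have e : ((a * b) • bracketBasis K m n).2 =
              a * b * (if m + n = 0 then algebraMap ℚ K (((m : ℚ) ^ 3 - m) / 12) else 0) := by
            change a * b * (((m - n : ℤ) : K) * 0 + _ * (1 : K)) = _
            rw [mul_zero, zero_add, mul_one]
          rw [bracketAux_single, e, Finsupp.linearCombination_single,
            Finsupp.linearCombination_single, smul_lie, lie_smul, h, bracketBasis]
          simp only [map_smul, map_add, proj_L, proj_central, smul_zero, add_zero,
            Finsupp.linearCombination_single, one_smul, smul_add, smul_smul,
            VirasoroWord.cocycle]
          congr 2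
          · ring
          · split_ifs <;> ring
    have hc : ∀ (a b : K) (f g : Module.End K V),
        ⁅f + a • (1 : Module.End K V), g + b • (1 : Module.End K V)⁆ = ⁅f, g⁆ := by
      intro a b f g
      simp only [LieRing.of_associative_ring_bracket, add_mul, mul_add, smul_mul_assoc,
        mul_smul_comm, one_mul, mul_one, smul_add, smul_smul, mul_comm b a]
      abel
    rw [hc]
    exact key _ _

theorem repOfModes_L (ℓ : ℤ → Module.End K V) (cc : K) (h) (n : ℤ) :
    repOfModes ℓ cc h (L K n) = ℓ n := by
  change Finsupp.linearCombination K ℓ (Finsupp.single n 1) + ((0 : K) * cc) • _ = _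
  simp

theorem repOfModes_central (ℓ : ℤ → Module.End K V) (cc : K) (h) :
    repOfModes ℓ cc h (central K) = cc • 1 := by
  change Finsupp.linearCombination K ℓ 0 + ((1 : K) * cc) • _ = _
  simp

end Virasoro

namespace VirasoroWord

attribute [local instance] LieRing.ofAssociativeRing

variable {K : Type*} [CommRing K] [Algebra ℚ K] (cc : K)

/-- The functions on words that respect the Virasoro relations. -/
def wordFunctions : Submodule K (List ℤ → K) where
  carrier := {φ | ∀ a m n b, φ (a ++ m :: n :: b) = swapped cc φ a m n b}
  zero_mem' a m n b := by simp [swapped]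
  add_mem' {φ ψ} hφ hψ a m n b := by
    rw [Pi.add_apply, hφ, hψ]; simp only [swapped, Pi.add_apply]; ring
  smul_mem' c φ hφ a m n b := by
    rw [Pi.smul_apply, hφ]; simp only [swapped, Pi.smul_apply, smul_eq_mul]; ring

/-- `L_n` acts on functions on words by right translation. -/
def translate (n : ℤ) : Module.End K (wordFunctions cc) where
  toFun φ := ⟨fun w => φ.1 (w ++ [n]), fun a m k b => by
    have := φ.2 a m k (b ++ [n])
    simpa [swapped] using this⟩
  map_add' _ _ := rfl
  map_smul' _ _ := rfl

theorem translate_lie (m n : ℤ) : ⁅translate cc m, translate cc n⁆ =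
    ((m - n : ℤ) : K) • translate cc (m + n) + cocycle cc m n • 1 := by
  change translate cc m * translate cc n - translate cc n * translate cc m = _
  ext φ w
  have := φ.2 w m n []
  simp only [swapped, List.append_nil] at this
  simp [translate, this]
  ring

/-- The action of the enveloping algebra on functions on words. -/
noncomputable def translateU :
    UniversalEnvelopingAlgebra K (Virasoro K) →ₐ[K] Module.End K (wordFunctions cc) :=
  UniversalEnvelopingAlgebra.lift K (Virasoro.repOfModes _ cc (translate_lie cc))

theorem translateU_genU (n : ℤ) :
    translateU cc (IrregularParams.genU K n) = translate cc n := by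
  rw [translateU, IrregularParams.genU, UniversalEnvelopingAlgebra.lift_ι_apply,
    Virasoro.repOfModes_L]

theorem translateU_word (w : List ℤ) (φ : wordFunctions cc) (u : List ℤ) :
    (translateU cc (w.map (IrregularParams.genU K)).prod φ).1 u = φ.1 (u ++ w) := by
  induction w generalizing u with
  | nil => simp
  | cons n w ih =>
    rw [List.map_cons, List.prod_cons, map_mul, translateU_genU]
    change (translateU cc (w.map (IrregularParams.genU K)).prod φ).1 (u ++ [n]) = _
    rw [ih]
    simp

end VirasoroWord

namespace IrregularParams

attribute [local instance] LieRing.ofAssociativeRing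

open VirasoroWord

variable {K : Type*} [CommRing K] {r : ℕ} (p : IrregularParams K r)

theorem lower_zero : p.lower 0 = 0 := dif_neg (by omega)

theorem lower_of_lt {j : ℕ} (h : r - 1 < j) : p.lower j = 0 := dif_neg (by omega)

theorem lowerWeight_of_lt {n : ℕ} (h : 2 * (r - 1) < n) : p.lowerWeight n = 0 := by
  rw [lowerWeight, irregularWeight, p.lower_of_lt (by omega), mul_zero, zero_sub, neg_eq_zero]
  refine Finset.sum_eq_zero fun k _ => ?_
  rcases lt_or_ge (r - 1) k with hk | hk
  · rw [p.lower_of_lt hk, zero_mul]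
  · rw [p.lower_of_lt (j := n - k) (by omega), mul_zero]

theorem lowerWeight_two_mul (hr : 2 ≤ r) :
    p.lowerWeight (2 * (r - 1)) = -(p.lower (r - 1) * p.lower (r - 1)) := by
  rw [lowerWeight, irregularWeight, p.lower_of_lt (by omega), mul_zero, zero_sub,
    Finset.sum_eq_single (r - 1)]
  · congr 3; omega
  · intro k _ hk
    rcases lt_or_ge (r - 1) k with hk' | hk'
    · rw [p.lower_of_lt hk', zero_mul]
    · rw [p.lower_of_lt (j := 2 * (r - 1) - k) (by omega), mul_zero]
  · intro h; exact absurd (Finset.mem_Icc.2 ⟨by omega, by omega⟩) h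

variable [Algebra ℚ K]

theorem genU_mul_genU (m n : ℤ) : genU K m * genU K n = genU K n * genU K m +
    (((m - n : ℤ) : K) • genU K (m + n) +
      (if m + n = 0 then algebraMap ℚ K (((m : ℚ) ^ 3 - m) / 12) else 0) •
        UniversalEnvelopingAlgebra.ι K (Virasoro.central K)) := by
  have h := (UniversalEnvelopingAlgebra.ι K).map_lie (Virasoro.L K m) (Virasoro.L K n)
  rw [Virasoro.lie_L_L, map_add, map_smul, map_smul, LieRing.of_associative_ring_bracket] at h
  rw [genU, genU, genU, h]
  abel

theorem central_mul_ι (x : Virasoro K) :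
    UniversalEnvelopingAlgebra.ι K (Virasoro.central K) * UniversalEnvelopingAlgebra.ι K x =
      UniversalEnvelopingAlgebra.ι K x * UniversalEnvelopingAlgebra.ι K (Virasoro.central K) := by
  have h := (UniversalEnvelopingAlgebra.ι K).map_lie x (Virasoro.central K)
  rw [Virasoro.lie_central, map_zero, LieRing.of_associative_ring_bracket] at h
  exact (sub_eq_zero.1 h.symm).symm

theorem adjoin_range_ι : Algebra.adjoin K (Set.range (UniversalEnvelopingAlgebra.ι K :
    Virasoro K → UniversalEnvelopingAlgebra K (Virasoro K))) = ⊤ := by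
  set A := Algebra.adjoin K (Set.range (UniversalEnvelopingAlgebra.ι K :
    Virasoro K → UniversalEnvelopingAlgebra K (Virasoro K)))
  let f : Virasoro K →ₗ⁅K⁆ A :=
    { toFun := fun x => ⟨UniversalEnvelopingAlgebra.ι K x, Algebra.subset_adjoin ⟨x, rfl⟩⟩
      map_add' := fun x y => Subtype.ext (map_add _ x y)
      map_smul' := fun a x => Subtype.ext (map_smul _ a x)
      map_lie' := fun {x y} => Subtype.ext (LieHom.map_lie _ x y) }
  have h : A.val.comp (UniversalEnvelopingAlgebra.lift K f) = AlgHom.id K _ := by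
    ext x
    simp only [LieHom.comp_apply, AlgHom.toLieHom_apply, AlgHom.comp_apply,
      UniversalEnvelopingAlgebra.lift_ι_apply]
    rfl
  rw [eq_top_iff]
  intro u _
  have := congrArg (fun g => g u) h
  simp only [AlgHom.comp_apply, AlgHom.id_apply] at this
  rw [← this]
  exact (UniversalEnvelopingAlgebra.lift K f u).2

theorem central_commute (u : UniversalEnvelopingAlgebra K (Virasoro K)) :
    Commute (UniversalEnvelopingAlgebra.ι K (Virasoro.central K)) u := by
  have hu : u ∈ Algebra.adjoin K (Set.range (UniversalEnvelopingAlgebra.ι K :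
    Virasoro K → UniversalEnvelopingAlgebra K (Virasoro K))) := by
    rw [adjoin_range_ι]; trivial
  induction hu using Algebra.adjoin_induction with
  | mem x hx => obtain ⟨x, rfl⟩ := hx; exact central_mul_ι x
  | algebraMap a => exact (Algebra.commutes a _).symm
  | add x y _ _ hx hy => exact hx.add_right hy
  | mul x y _ _ hx hy => exact hx.mul_right hy

theorem smul_vac (u : UniversalEnvelopingAlgebra K (Virasoro K)) :
    u • p.vac = Submodule.Quotient.mk u := by
  rw [vac, ← Submodule.Quotient.mk_smul, smul_eq_mul, mul_one]

/-- The irregular vector generates the irregular Verma module. -/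
theorem exists_smul_vac (x : p.Verma) :
    ∃ u : UniversalEnvelopingAlgebra K (Virasoro K), x = u • p.vac := by
  obtain ⟨u, rfl⟩ := Submodule.Quotient.mk_surjective _ x
  exact ⟨u, (p.smul_vac u).symm⟩

theorem central_smul (x : p.Verma) :
    UniversalEnvelopingAlgebra.ι K (Virasoro.central K) • x = p.centralCharge • x := by
  obtain ⟨u, rfl⟩ := p.exists_smul_vac x
  rw [smul_smul, (central_commute u).eq, mul_smul]
  have h : UniversalEnvelopingAlgebra.ι K (Virasoro.central K) • p.vac =
      algebraMap K (UniversalEnvelopingAlgebra K (Virasoro K)) p.centralCharge • p.vac := by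
    rw [smul_vac, smul_vac, Submodule.Quotient.eq]
    exact Submodule.subset_span (Or.inr rfl)
  rw [h, algebraMap_smul, smul_comm]

theorem genU_smul_vac {n : ℕ} (hn : r - 1 ≤ n) :
    genU K n • p.vac = p.lowerWeight n • p.vac := by
  rw [← algebraMap_smul (UniversalEnvelopingAlgebra K (Virasoro K)) (p.lowerWeight n) p.vac,
    smul_vac, smul_vac, Submodule.Quotient.eq]
  exact Submodule.subset_span (Or.inl ⟨n, hn, rfl⟩)

theorem genU_smul_genU_smul (m n : ℤ) (x : p.Verma) :
    genU K m • genU K n • x = genU K n • genU K m • x + ((m - n : ℤ) : K) • genU K (m + n) • x +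
      cocycle p.centralCharge m n • x := by
  rw [smul_smul, genU_mul_genU, add_smul, mul_smul, add_smul, add_assoc, smul_assoc, smul_assoc,
    central_smul, smul_smul, cocycle]
  split_ifs
  · rw [mul_smul, mul_smul]
  · simp

/-- The irregular Verma module, with the action of the `L_n`. -/
noncomputable def modes (hr : 2 ≤ r) (hu : IsUnit (p.lower (r - 1))) :
    IrregularModes K p.Verma where
  mode n := Algebra.lsmul K K p.Verma (genU K n)
  charge := p.centralCharge
  s := r - 1
  vac := p.vac
  eig := p.lowerWeight
  κ := p.lower (r - 1) * p.lower (r - 1)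
  one_le_s := by omega
  comm m n x := p.genU_smul_genU_smul m n x
  mode_vac n hn := p.genU_smul_vac hn
  eig_of_lt n hn := p.lowerWeight_of_lt hn
  eig_two_mul := p.lowerWeight_two_mul hr
  isUnit_κ := hu.mul hu

/-- The irregular vector generates the irregular Verma module under the `L_n`. -/
theorem eq_top_of_genU_smul_mem {N : Submodule K p.Verma} (h0 : p.vac ∈ N)
    (h : ∀ n, ∀ x ∈ N, genU K n • x ∈ N) : N = ⊤ := by
  have hι : ∀ x : Virasoro K, ∀ y ∈ N, UniversalEnvelopingAlgebra.ι K x • y ∈ N := by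
    intro x y hy
    have hx : x = Finsupp.linearCombination K (Virasoro.L K) (Virasoro.proj K x) +
        x.2 • Virasoro.central K := by
      obtain ⟨f, z⟩ := x
      change _ = Finsupp.linearCombination K (Virasoro.L K) f + z • Virasoro.central K
      have e : z • Virasoro.central K = ((0, z) : (ℤ →₀ K) × K) := by
        change ((z • (0 : ℤ →₀ K), z * 1) : (ℤ →₀ K) × K) = _
        simp
      have e' : Finsupp.linearCombination K (Virasoro.L K) f = ((f, 0) : (ℤ →₀ K) × K) := by
        induction f using Finsupp.induction_linear with
        | zero => rw [map_zero]; rfl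
        | add f g hf hg =>
          rw [map_add, hf, hg]
          change ((f + g, (0 : K) + 0) : (ℤ →₀ K) × K) = _
          rw [add_zero]
        | single n a =>
          rw [Finsupp.linearCombination_single]
          change ((a • Finsupp.single n (1 : K), a * 0) : (ℤ →₀ K) × K) = _
          simp
      rw [e, e']
      change _ = ((f + 0, 0 + z) : (ℤ →₀ K) × K)
      rw [add_zero, zero_add]
    rw [hx, map_add, map_smul, add_smul, smul_assoc, central_smul]
    refine add_mem ?_ (N.smul_mem _ (N.smul_mem _ hy))
    rw [Finsupp.linearCombination_apply, Finsupp.sum, map_sum, Finset.sum_smul]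
    refine sum_mem fun n _ => ?_
    rw [map_smul, smul_assoc]
    exact N.smul_mem _ (h n y hy)
  have hall : ∀ u : UniversalEnvelopingAlgebra K (Virasoro K), ∀ y ∈ N, u • y ∈ N := by
    intro u
    have hu : u ∈ Algebra.adjoin K (Set.range (UniversalEnvelopingAlgebra.ι K :
        Virasoro K → UniversalEnvelopingAlgebra K (Virasoro K))) := by
      rw [adjoin_range_ι]; trivial
    induction hu using Algebra.adjoin_induction with
    | mem x hx => obtain ⟨x, rfl⟩ := hx; exact hι x
    | algebraMap a => intro y hy; rw [algebraMap_smul]; exact N.smul_mem _ hy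
    | add x z _ _ hx hz => intro y hy; rw [add_smul]; exact add_mem (hx y hy) (hz y hy)
    | mul x z _ _ hx hz => intro y hy; rw [mul_smul]; exact hx _ (hz y hy)
  rw [eq_top_iff]
  intro x _
  obtain ⟨u, rfl⟩ := p.exists_smul_vac x
  exact hall u _ h0

/-- The eigenvalues of the `L_n` on the irregular vector, extended to all
integers; the values below `r - 1` play no role. -/
def lowerWeightInt (n : ℤ) : K := p.lowerWeight n.toNat

/-- The constant term as a function on words. -/
noncomputable def wordConstTerm : wordFunctions p.centralCharge :=
  ⟨constTerm p.centralCharge (r - 1) p.lowerWeightInt,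
    constTerm_eq_swapped p.centralCharge (r - 1) p.lowerWeightInt⟩

/-- The constant term is invariant under the left ideal defining the irregular Verma module. -/
theorem translateU_wordConstTerm_of_mem (hr : 2 ≤ r)
    {u : UniversalEnvelopingAlgebra K (Virasoro K)} (hu : u ∈ p.vermaIdeal) :
    translateU p.centralCharge u p.wordConstTerm = 0 := by
  induction hu using Submodule.span_induction with
  | mem x h =>
    rcases h with ⟨n, hn, rfl⟩ | rfl
    · rw [map_sub, AlgHom.commutes, translateU_genU, LinearMap.sub_apply,
        Module.algebraMap_end_apply, sub_eq_zero]
      ext w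
      exact constTerm_append p.centralCharge (r - 1) p.lowerWeightInt (by omega)
        (fun n hn => p.lowerWeight_of_lt (by omega)) w (by omega)
    · rw [map_sub, AlgHom.commutes, translateU, UniversalEnvelopingAlgebra.lift_ι_apply,
        Virasoro.repOfModes_central, LinearMap.sub_apply, Module.algebraMap_end_apply]
      simp
  | zero => simp
  | add x y _ _ hx hy => rw [map_add, LinearMap.add_apply, hx, hy, add_zero]
  | smul a x _ hx => rw [smul_eq_mul, map_mul, Module.End.mul_apply, hx, map_zero]

/-- The constant term, as a linear functional on the irregular Verma module. -/
noncomputable def constFunctional (hr : 2 ≤ r) : p.Verma →ₗ[K] K :=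
  ((p.vermaIdeal.restrictScalars K).liftQ
    ((LinearMap.proj (R := K) (φ := fun _ : List ℤ => K) []).comp
      ((wordFunctions p.centralCharge).subtype.comp
        ((LinearMap.applyₗ p.wordConstTerm).comp (translateU p.centralCharge).toLinearMap)))
    fun u hu => by
      simp only [LinearMap.mem_ker, LinearMap.comp_apply, AlgHom.toLinearMap_apply,
        LinearMap.applyₗ_apply_apply]
      rw [p.translateU_wordConstTerm_of_mem hr hu]
      simp).comp
  (Submodule.Quotient.restrictScalarsEquiv K p.vermaIdeal).symm.toLinearMap

theorem constFunctional_smul_vac (hr : 2 ≤ r) (u : UniversalEnvelopingAlgebra K (Virasoro K)) :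
    p.constFunctional hr (u • p.vac) = (translateU p.centralCharge u p.wordConstTerm).1 [] := by
  rw [smul_vac]; rfl

theorem constFunctional_word (hr : 2 ≤ r) (w : List ℤ) :
    p.constFunctional hr ((w.map (genU K)).prod • p.vac) =
      constTerm p.centralCharge (r - 1) p.lowerWeightInt w := by
  rw [constFunctional_smul_vac, translateU_word]
  rfl

theorem constFunctional_vac (hr : 2 ≤ r) : p.constFunctional hr p.vac = 1 := by
  have h := p.constFunctional_word hr []
  rw [constTerm_of_not_hasDescent _ _ _ (not_hasDescent_of_pairwise List.Pairwise.nil)] at h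
  simpa using h

theorem constFunctional_pbw (hr : 2 ≤ r) {m : ℕ} (hm : 0 < m) (lam : m.Partition) :
    p.constFunctional hr (p.pbw lam) = 0 := by
  have e : p.pbw lam = (((lam.parts.sort (· ≥ ·)).map fun i : ℕ => (r : ℤ) - 1 - i).map
      (genU K)).prod • p.vac := by
    rw [List.map_map]; rfl
  have hpw : ((lam.parts.sort (· ≥ ·)).map fun i : ℕ => (r : ℤ) - 1 - i).Pairwise (· ≤ ·) := by
    rw [List.pairwise_map]
    refine (Multiset.pairwise_sort lam.parts (· ≥ ·)).imp fun h => ?_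
    omega
  rw [e, constFunctional_word, constTerm_of_not_hasDescent _ _ _ (not_hasDescent_of_pairwise hpw),
    if_neg]
  intro h
  have hne : lam.parts ≠ 0 := by
    intro h0
    have := lam.parts_sum
    rw [h0] at this
    simp at this
    omega
  obtain ⟨i, hi⟩ := Multiset.exists_mem_of_ne_zero hne
  have h1 := h ((r : ℤ) - 1 - i) (List.mem_map.2 ⟨i, (Multiset.mem_sort _).2 hi, rfl⟩)
  have := lam.parts_pos hi
  omega

theorem constFunctional_eq_of_isConstantTerm (hr : 2 ≤ r) {u : p.Verma} {a : K}
    (h : p.IsConstantTerm u a) : p.constFunctional hr u = a := by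
  have hle : Submodule.span K {x : p.Verma | ∃ (m : ℕ) (lam : m.Partition), 0 < m ∧ x = p.pbw lam}
      ≤ LinearMap.ker (p.constFunctional hr) := by
    rw [Submodule.span_le]
    rintro _ ⟨m, lam, hm, rfl⟩
    exact p.constFunctional_pbw hr hm lam
  have := hle h
  rw [LinearMap.mem_ker, map_sub, map_smul, constFunctional_vac, smul_eq_mul, mul_one,
    sub_eq_zero] at this
  exact this

/-- Every vector has a constant term: words in the `L_n` applied to the irregular vector can be
sorted, and the letters `L_n` with `n ≥ r - 1` at the end of a sorted word act by scalars. -/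
theorem exists_isConstantTerm (hr : 2 ≤ r) (u : p.Verma) : ∃ a, p.IsConstantTerm u a := by
  let B := Submodule.span K {x : p.Verma | ∃ (m : ℕ) (lam : m.Partition), 0 < m ∧ x = p.pbw lam}
  have hword : ∀ w : List ℤ, (w.map (genU K)).prod • p.vac ∈ B ⊔ Submodule.span K {p.vac} := by
    intro w
    induction w using descent_induction with
    | sorted w ih hw =>
      rcases List.eq_nil_or_concat w with rfl | ⟨w', n, rfl⟩
      · simpa using Submodule.mem_sup_right (Submodule.mem_span_singleton_self p.vac)
      rw [List.concat_eq_append] at *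
      rcases le_or_gt ((r : ℤ) - 1) n with hn | hn
      · obtain ⟨k, rfl⟩ : ∃ k : ℕ, n = k := ⟨n.toNat, by omega⟩
        rw [List.map_append, List.prod_append, mul_smul]
        simp only [List.map_cons, List.map_nil, List.prod_singleton]
        rw [p.genU_smul_vac (by omega), smul_comm]
        exact Submodule.smul_mem _ _ (ih w' (by simp))
      · refine Submodule.mem_sup_left (Submodule.subset_span ?_)
        have hpw := pairwise_of_not_hasDescent hw
        have hlt : ∀ x ∈ w' ++ [n], x ≤ (r : ℤ) - 1 - 1 := by
          intro x hx
          rw [List.pairwise_append] at hpw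
          rcases List.mem_append.1 hx with hx | hx
          · have := hpw.2.2 x hx n (by simp); omega
          · simp at hx; omega
        generalize hW : w' ++ [n] = W at *
        let P : Multiset ℕ := (W.map fun x => ((r : ℤ) - 1 - x).toNat : List ℕ)
        have hP : ∀ i ∈ P, 0 < i := by
          intro i hi
          obtain ⟨x, hx, rfl⟩ := List.mem_map.1 (Multiset.mem_coe.1 hi)
          have := hlt x hx
          omega
        have hsort : P.sort (· ≥ ·) = W.map fun x => ((r : ℤ) - 1 - x).toNat := by
          refine List.Perm.eq_of_pairwise' (r := (· ≥ ·)) (Multiset.pairwise_sort _ _) ?_ ?_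
          · rw [List.pairwise_map]
            exact hpw.imp fun h => by omega
          · rw [← Multiset.coe_eq_coe, Multiset.sort_eq]
        refine ⟨P.sum, ⟨P, fun {i} hi => hP i hi, rfl⟩, ?_, ?_⟩
        · obtain ⟨x, hx⟩ : ∃ x, x ∈ W := ⟨n, by rw [← hW]; simp⟩
          have h1 : ((r : ℤ) - 1 - x).toNat ∈ P := Multiset.mem_coe.2 (List.mem_map.2 ⟨x, hx, rfl⟩)
          exact (hP _ h1).trans_le (Multiset.single_le_sum (fun _ _ => Nat.zero_le _) _ h1)
        · rw [pbw, hsort, List.map_map]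
          congr 2
          refine List.map_congr_left fun x hx => ?_
          have := hlt x hx
          simp only [Function.comp_apply]
          congr 1
          omega
    | step a m n b _ ih1 ih2 =>
      have e : ((a ++ m :: n :: b).map (genU K)).prod • p.vac =
          ((a ++ n :: m :: b).map (genU K)).prod • p.vac +
          ((m - n : ℤ) : K) • ((a ++ (m + n) :: b).map (genU K)).prod • p.vac +
          cocycle p.centralCharge m n • ((a ++ b).map (genU K)).prod • p.vac := by
        simp only [List.map_append, List.map_cons, List.prod_append, List.prod_cons, mul_smul]
        rw [genU_smul_genU_smul, smul_add, smul_add, smul_comm _ ((m - n : ℤ) : K),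
          smul_comm _ (cocycle p.centralCharge m n)]
      rw [e]
      exact add_mem (add_mem ih2 (Submodule.smul_mem _ _ (ih1 _ (by simp))))
        (Submodule.smul_mem _ _ (ih1 _ (by simp)))
  have htop : Submodule.span K (Set.range fun w : List ℤ => (w.map (genU K)).prod • p.vac) = ⊤ := by
    refine p.eq_top_of_genU_smul_mem (Submodule.subset_span ⟨[], by simp⟩) fun n x hx => ?_
    induction hx using Submodule.span_induction with
    | mem x h =>
      obtain ⟨w, rfl⟩ := h
      exact Submodule.subset_span ⟨n :: w, by simp [mul_smul]⟩
    | zero => rw [smul_zero]; exact zero_mem _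
    | add x y _ _ hx hy => rw [smul_add]; exact add_mem hx hy
    | smul a x _ hx => rw [smul_comm]; exact Submodule.smul_mem _ _ hx
  have hu : u ∈ B ⊔ Submodule.span K {p.vac} := by
    have : Submodule.span K (Set.range fun w : List ℤ => (w.map (genU K)).prod • p.vac) ≤
        B ⊔ Submodule.span K {p.vac} := by
      rw [Submodule.span_le]
      rintro _ ⟨w, rfl⟩
      exact hword w
    exact this (htop ▸ Submodule.mem_top)
  obtain ⟨y, hy, z, hz, rfl⟩ := Submodule.mem_sup.1 hu
  obtain ⟨a, rfl⟩ := Submodule.mem_span_singleton.1 hz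
  exact ⟨a, by rw [IsConstantTerm, add_sub_cancel_right]; exact hy⟩

/-- Constant terms exist and are unique. -/
theorem isConstantTerm_iff (hr : 2 ≤ r) (u : p.Verma) (a : K) :
    p.IsConstantTerm u a ↔ a = p.constFunctional hr u := by
  constructor
  · intro h
    exact (p.constFunctional_eq_of_isConstantTerm hr h).symm
  · rintro rfl
    obtain ⟨a, ha⟩ := p.exists_isConstantTerm hr u
    rwa [p.constFunctional_eq_of_isConstantTerm hr ha]

end IrregularParams

/-! ### Series with coefficients in a module -/

namespace HahnModule

variable {K K' V V' : Type*} [CommRing K] [CommRing K'] [AddCommGroup V] [Module K V]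
  [AddCommGroup V'] [Module K' V'] {σ : K →+* K'}

/-- A semilinear map applied to the coefficients of a series. -/
noncomputable def mapCoeff (A : V →ₛₗ[σ] V') (F : HahnModule ℤ K V) : HahnModule ℤ K' V' :=
  of K' (((of K).symm F).map A)

theorem coeff_mapCoeff (A : V →ₛₗ[σ] V') (F : HahnModule ℤ K V) (n : ℤ) :
    ((of K').symm (mapCoeff A F)).coeff n = A (((of K).symm F).coeff n) := rfl

theorem ext_coeff {F G : HahnModule ℤ K V}
    (h : ∀ n, ((of K).symm F).coeff n = ((of K).symm G).coeff n) : F = G :=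
  HahnModule.ext _ _ (funext h)

theorem mapCoeff_add (A : V →ₛₗ[σ] V') (F G : HahnModule ℤ K V) :
    mapCoeff A (F + G) = mapCoeff A F + mapCoeff A G :=
  ext_coeff fun _ => map_add A _ _

theorem mapCoeff_sub (A : V →ₛₗ[σ] V') (F G : HahnModule ℤ K V) :
    mapCoeff A (F - G) = mapCoeff A F - mapCoeff A G :=
  ext_coeff fun _ => map_sub A _ _

theorem mapCoeff_sum {ι : Type*} (A : V →ₛₗ[σ] V') (s : Finset ι) (F : ι → HahnModule ℤ K V) :
    mapCoeff A (∑ i ∈ s, F i) = ∑ i ∈ s, mapCoeff A (F i) :=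
  map_sum (AddMonoidHom.mk' (mapCoeff A) (mapCoeff_add A)) F s

theorem mapCoeff_smul (A : V →ₛₗ[σ] V') (f : LaurentSeries K) (F : HahnModule ℤ K V) :
    mapCoeff A (f • F) = (f.map σ : LaurentSeries K') • mapCoeff A F := by
  refine ext_coeff fun n => ?_
  rw [coeff_mapCoeff, coeff_smul, coeff_smul, map_sum]
  symm
  refine (Finset.sum_subset (fun ij h => ?_) fun ij h h' => ?_).trans
    (Finset.sum_congr rfl fun ij _ => (map_smulₛₗ A _ _).symm)
  · simp only [Finset.mem_vaddAntidiagonal, HahnSeries.mem_support] at h ⊢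
    refine ⟨fun h0 => h.1 ?_, fun h0 => h.2.1 ?_, h.2.2⟩
    · rw [HahnSeries.map_coeff, h0, map_zero]
    · rw [coeff_mapCoeff, h0, map_zero]
  · simp only [Finset.mem_vaddAntidiagonal, HahnSeries.mem_support] at h h'
    by_cases h1 : (f.map σ : LaurentSeries K').coeff ij.1 = 0
    · rw [h1, zero_smul]
    · by_cases h2 : ((of K').symm (mapCoeff A F)).coeff ij.2 = 0
      · rw [h2, smul_zero]
      · exact absurd ⟨h1, h2, h.2.2⟩ h'

theorem mapCoeff_smul_linear {W : Type*} [AddCommGroup W] [Module K W] (A : V →ₗ[K] W)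
    (f : LaurentSeries K) (F : HahnModule ℤ K V) :
    mapCoeff A (f • F) = f • mapCoeff A F := by
  rw [mapCoeff_smul]
  rfl

/-- The Euler operator `∑ F_n t^n ↦ ∑ n F_n t^n`. -/
noncomputable def theta (F : HahnModule ℤ K V) : HahnModule ℤ K V :=
  of K ⟨fun n => n • ((of K).symm F).coeff n, ((of K).symm F).isPWO_support.mono fun n h h0 =>
    h (by beta_reduce; rw [h0, smul_zero])⟩

theorem coeff_theta (F : HahnModule ℤ K V) (n : ℤ) :
    ((of K).symm (theta F)).coeff n = n • ((of K).symm F).coeff n := rfl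

/-- The Euler operator on scalar series. -/
noncomputable def thetaScalar (f : LaurentSeries K) : LaurentSeries K :=
  (of K).symm (theta (of K f))

theorem coeff_thetaScalar (f : LaurentSeries K) (n : ℤ) :
    (thetaScalar f).coeff n = n • f.coeff n := rfl

theorem theta_smul (f : LaurentSeries K) (F : HahnModule ℤ K V) :
    theta (f • F) = thetaScalar f • F + f • theta F := by
  refine ext_coeff fun n => ?_
  have hs : ∀ G : HahnModule ℤ K V, ((of K).symm (theta G)).support ⊆ ((of K).symm G).support :=
    fun G n h h0 => h (by rw [coeff_theta, h0, smul_zero])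
  have hs' : (thetaScalar f).support ⊆ f.support :=
    fun n h h0 => h (by rw [coeff_thetaScalar, h0, smul_zero])
  rw [coeff_theta, of_symm_add, HahnSeries.coeff_add,
    coeff_smul_left f.isPWO_support hs',
    coeff_smul_right ((of K).symm F).isPWO_support (hs F), coeff_smul, Finset.smul_sum,
    ← Finset.sum_add_distrib]
  refine Finset.sum_congr rfl fun ij h => ?_
  rw [Finset.mem_vaddAntidiagonal] at h
  have hn : ij.1 + ij.2 = n := h.2.2
  rw [coeff_theta, coeff_thetaScalar, ← hn, add_zsmul, smul_assoc, smul_comm (f.coeff ij.1)]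

theorem theta_mapCoeff (A : V →ₛₗ[σ] V') (F : HahnModule ℤ K V) :
    theta (mapCoeff A F) = mapCoeff A (theta F) :=
  ext_coeff fun n => (map_zsmul A n _).symm

theorem coeff_single_smul (k : ℤ) (a : K) (F : HahnModule ℤ K V) (n : ℤ) :
    ((of K).symm ((HahnSeries.single k a : LaurentSeries K) • F)).coeff n =
      a • ((of K).symm F).coeff (n - k) := by
  have := coeff_single_smul_vadd (r := a) (x := F) (a := n - k) (b := k)
  rwa [vadd_eq_add, add_sub_cancel] at this

theorem coeff_C_smul (a : K) (F : HahnModule ℤ K V) (n : ℤ) :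
    ((of K).symm ((HahnSeries.C a : LaurentSeries K) • F)).coeff n =
      a • ((of K).symm F).coeff n := by
  have := coeff_single_smul 0 a F n
  rwa [sub_zero] at this

/-- A functional applied to the coefficients of a series. -/
noncomputable def evalCoeff (ε : V →ₗ[K] K) (F : HahnModule ℤ K V) : LaurentSeries K :=
  (of K).symm (mapCoeff ε F)

theorem coeff_evalCoeff (ε : V →ₗ[K] K) (F : HahnModule ℤ K V) (n : ℤ) :
    (evalCoeff ε F).coeff n = ε (((of K).symm F).coeff n) := rfl

theorem evalCoeff_smul (ε : V →ₗ[K] K) (f : LaurentSeries K) (F : HahnModule ℤ K V) :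
    evalCoeff ε (f • F) = f * evalCoeff ε F := by
  rw [evalCoeff, mapCoeff_smul_linear]
  rfl

theorem evalCoeff_sub (ε : V →ₗ[K] K) (F G : HahnModule ℤ K V) :
    evalCoeff ε (F - G) = evalCoeff ε F - evalCoeff ε G := by
  rw [evalCoeff, mapCoeff_sub]
  rfl

theorem evalCoeff_sum {ι : Type*} (ε : V →ₗ[K] K) (s : Finset ι) (F : ι → HahnModule ℤ K V) :
    evalCoeff ε (∑ i ∈ s, F i) = ∑ i ∈ s, evalCoeff ε (F i) := by
  rw [evalCoeff, mapCoeff_sum]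
  exact map_sum (AddMonoidHom.mk' (fun x : HahnModule ℤ K K => (of K).symm x)
    (fun _ _ => rfl)) _ _

/-- A nonzero series has a lowest coefficient. -/
theorem exists_coeff_ne_zero {F : HahnModule ℤ K V} (hF : F ≠ 0) :
    ∃ n : ℤ, ((of K).symm F).coeff n ≠ 0 ∧ ∀ m < n, ((of K).symm F).coeff m = 0 := by
  have h : (of K).symm F ≠ 0 := fun h => hF h
  exact ⟨((of K).symm F).order, fun h0 => h (HahnSeries.coeff_order_eq_zero.1 h0),
    fun m hm => HahnSeries.coeff_eq_zero_of_lt_order hm⟩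

end HahnModule

/-! ### The weights as polynomials in `c_r` -/

namespace IrregularParams

open HahnModule

variable {K : Type*} [CommRing K] {r : ℕ} (p : IrregularParams K r)

theorem isUnit_top : IsUnit p.top :=
  IsUnit.of_mul_eq_one (HahnSeries.single (-1) 1) (by simp [top, HahnSeries.single_mul_single])

/-- The coefficient of `c_r` in `Λ_n`, for `n ≥ r`. -/
def weightLinear (n : ℕ) : K :=
  (if n = r then ((n : K) + 1) * p.Q - p.c₀ else 0) - 2 * p.lower (n - r)

/-- The coefficient of `c_r²` in `Λ_n`, for `n ≥ r`. -/
def weightQuadratic (_p : IrregularParams K r) (n : ℕ) : K := if n = 2 * r then -1 else 0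

theorem upper_eq (hr : 1 ≤ r) (j : ℕ) :
    p.upper j = HahnSeries.C (p.lower j) + p.top * if j = r then 1 else 0 := by
  unfold upper
  split_ifs with h
  · rw [h, p.lower_of_lt (by omega)]; simp
  · simp

theorem upper_zero (hr : 1 ≤ r) : p.upper 0 = 0 := by
  rw [upper, if_neg (by omega), lower_zero, map_zero]

theorem upper_of_lt {j : ℕ} (h : r < j) : p.upper j = 0 := by
  rw [upper, if_neg (by omega), p.lower_of_lt (by omega), map_zero]

theorem upper_self : p.upper r = p.top := if_pos rfl

/-- For `n ≥ r`, the weight `Λ_n` is a quadratic polynomial in `c_r` with constant term `Λ'_n`. -/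
theorem weight_eq (hr : 1 ≤ r) {n : ℕ} (hn : r ≤ n) :
    p.weight n = HahnSeries.C (p.lowerWeight n) + p.top * HahnSeries.C (p.weightLinear n) +
      p.top ^ 2 * HahnSeries.C (p.weightQuadratic n) := by
  have h1 : ∑ k ∈ Finset.Icc 1 (n - 1),
      (HahnSeries.C (p.lower k) : LaurentSeries K) * (if n - k = r then 1 else 0) =
      HahnSeries.C (p.lower (n - r)) := by
    simp only [mul_ite, mul_one, mul_zero]
    rcases eq_or_lt_of_le hn with rfl | hlt
    · rw [Nat.sub_self, lower_zero, map_zero]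
      exact Finset.sum_eq_zero fun k hk => if_neg (by rw [Finset.mem_Icc] at hk; omega)
    · rw [Finset.sum_eq_single (n - r), if_pos (by omega)]
      · intro k hk hkn
        rw [Finset.mem_Icc] at hk
        exact if_neg (by omega)
      · intro h; exact absurd (Finset.mem_Icc.2 ⟨by omega, by omega⟩) h
  have h2 : ∑ k ∈ Finset.Icc 1 (n - 1),
      (if k = r then 1 else 0) * (HahnSeries.C (p.lower (n - k)) : LaurentSeries K) =
      HahnSeries.C (p.lower (n - r)) := by
    simp only [ite_mul, one_mul, zero_mul]
    rcases eq_or_lt_of_le hn with rfl | hlt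
    · rw [Nat.sub_self, lower_zero, map_zero]
      exact Finset.sum_eq_zero fun k hk => if_neg (by rw [Finset.mem_Icc] at hk; omega)
    · rw [Finset.sum_ite_eq' , if_pos (Finset.mem_Icc.2 ⟨by omega, by omega⟩)]
  have h3 : ∑ k ∈ Finset.Icc 1 (n - 1),
      ((if k = r then 1 else 0) * (if n - k = r then 1 else 0) : LaurentSeries K) =
      -HahnSeries.C (p.weightQuadratic n) := by
    rw [weightQuadratic]
    split_ifs with hnr
    · subst hnr
      rw [Finset.sum_eq_single r, if_pos rfl, if_pos (by omega)]
      · simp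
      · intro k _ hk; rw [if_neg hk, zero_mul]
      · intro h; exact absurd (Finset.mem_Icc.2 ⟨by omega, by omega⟩) h
    · rw [map_zero, neg_zero]
      refine Finset.sum_eq_zero fun k hk => ?_
      rw [Finset.mem_Icc] at hk
      by_cases hkr : k = r
      · rw [if_neg (show n - k ≠ r by omega), mul_zero]
      · rw [if_neg hkr, zero_mul]
  have hsum : ∑ k ∈ Finset.Icc 1 (n - 1), p.upper k * p.upper (n - k) =
      HahnSeries.C (∑ k ∈ Finset.Icc 1 (n - 1), p.lower k * p.lower (n - k)) +
        p.top * (2 * HahnSeries.C (p.lower (n - r))) -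
        p.top ^ 2 * HahnSeries.C (p.weightQuadratic n) := by
    have : ∀ k, p.upper k * p.upper (n - k) =
        HahnSeries.C (p.lower k * p.lower (n - k)) +
        p.top * (HahnSeries.C (p.lower k) * (if n - k = r then 1 else 0)) +
        p.top * ((if k = r then 1 else 0) * HahnSeries.C (p.lower (n - k))) +
        p.top ^ 2 * ((if k = r then 1 else 0) * (if n - k = r then 1 else 0)) := by
      intro k
      rw [p.upper_eq hr, p.upper_eq hr, map_mul]
      ring
    simp only [this, Finset.sum_add_distrib, ← Finset.mul_sum]
    rw [h1, h2, h3, map_sum]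
    ring
  rw [weight, irregularWeight, hsum, lowerWeight, irregularWeight,
    p.lower_of_lt (j := n) (by omega), weightLinear, p.upper_eq hr n,
    p.lower_of_lt (j := n) (by omega)]
  simp only [map_sub, map_mul, map_zero, mul_zero, zero_sub, zero_add, map_neg, map_ofNat]
  split_ifs
  · simp only [map_sub, map_mul, map_add, map_natCast, map_one]
    ring
  · simp only [map_zero]; ring

theorem weightLinear_of_lt {n : ℕ} (hr : 1 ≤ r) (hn : 2 * r < n) : p.weightLinear n = 0 := by
  rw [weightLinear, if_neg (by omega), p.lower_of_lt (by omega)]; ring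

theorem weightQuadratic_of_lt {n : ℕ} (hn : 2 * r < n) : p.weightQuadratic n = 0 :=
  if_neg (by omega)

theorem thetaScalar_weight (hr : 1 ≤ r) {n : ℕ} (hn : r ≤ n) :
    thetaScalar (p.weight n) = p.top * HahnSeries.C (p.weightLinear n) +
      2 * (p.top ^ 2 * HahnSeries.C (p.weightQuadratic n)) := by
  have e1 : ∀ a : K, p.top * HahnSeries.C a = HahnSeries.single 1 a := fun a => by
    rw [top, HahnSeries.C_apply, HahnSeries.single_mul_single]; simp
  have e2 : ∀ a : K, p.top ^ 2 * HahnSeries.C a = HahnSeries.single 2 a := fun a => by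
    rw [top, HahnSeries.C_apply, HahnSeries.single_pow, HahnSeries.single_mul_single]; simp
  rw [p.weight_eq hr hn, e1, e2]
  ext m
  rw [coeff_thetaScalar, two_mul]
  simp only [HahnSeries.coeff_add, HahnSeries.C_apply, HahnSeries.coeff_single]
  by_cases h0 : m = 0
  · subst h0; simp
  · by_cases h1 : m = 1
    · subst h1; simp
    · by_cases h2 : m = 2
      · subst h2; simp [two_smul]
      · simp [h0, h1, h2]

end IrregularParams

/-! ### The vector fields `𝒟_k` and the operator `L_*` -/

/-- The vector fields `𝒟_k = ∑_j j c_{k+j} ∂/∂c_j` act on the weights by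
`𝒟_k Λ_n = (n - k) Λ_{n+k}` for `n ≥ r`. -/
theorem sub_mul_irregularWeight {R : Type*} [CommRing R] (Q c₀ : R) (u : ℕ → R) {r n : ℕ}
    (h0 : u 0 = 0) (hu : ∀ i, r < i → u i = 0) (hr : 1 ≤ r) (hn : r ≤ n) (k : ℕ) :
    ((n : R) - k) * irregularWeight Q c₀ u (n + k) =
      ∑ j ∈ Finset.range r, (((j + 1 : ℕ) : R) * u (k + (j + 1))) *
        ((if j + 1 = n then ((n : R) + 1) * Q - c₀ else 0) - 2 * u (n - (j + 1))) := by
  set B := ∑ a ∈ Finset.range (n + k + 1), ((a : R) - k) * (u a * u (n + k - a)) with hB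
  have hA : ∑ a ∈ Finset.Icc 1 (n + k - 1), u a * u (n + k - a) =
      ∑ a ∈ Finset.range (n + k + 1), u a * u (n + k - a) := by
    refine Finset.sum_subset (fun a ha => ?_) fun a ha ha' => ?_
    · rw [Finset.mem_Icc] at ha
      rw [Finset.mem_range]; omega
    · rw [Finset.mem_range] at ha
      rw [Finset.mem_Icc] at ha'
      rcases Nat.eq_zero_or_pos a with rfl | hpos
      · rw [h0, zero_mul]
      · rw [show n + k - a = 0 by omega, h0, mul_zero]
  have hrefl : B = ∑ a ∈ Finset.range (n + k + 1),
      (((n + k : ℕ) : R) - a - k) * (u a * u (n + k - a)) := by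
    rw [hB, ← Finset.sum_range_reflect]
    refine Finset.sum_congr rfl fun a ha => ?_
    rw [Finset.mem_range] at ha
    rw [show n + k + 1 - 1 - a = n + k - a by omega, show n + k - (n + k - a) = a by omega,
      Nat.cast_sub (by omega)]
    ring
  have h2B : 2 * B = ((n : R) - k) * ∑ a ∈ Finset.range (n + k + 1), u a * u (n + k - a) := by
    rw [two_mul]
    nth_rewrite 1 [hrefl]
    rw [hB, ← Finset.sum_add_distrib, Finset.mul_sum]
    refine Finset.sum_congr rfl fun a _ => ?_
    push_cast
    ring
  have hB' : B = ∑ j ∈ Finset.range r, ((j + 1 : ℕ) : R) * (u (k + (j + 1)) * u (n - (j + 1))) := by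
    rw [hB, show n + k + 1 = (k + 1) + n by omega, Finset.sum_range_add,
      Finset.sum_eq_zero, zero_add]
    · symm
      refine (Finset.sum_subset (Finset.range_mono hn) fun j _ hj => ?_).trans
        (Finset.sum_congr rfl fun j hj => ?_)
      · rw [Finset.mem_range] at hj
        rw [hu (k + (j + 1)) (by omega), zero_mul, mul_zero]
      · rw [Finset.mem_range] at hj
        rw [show k + 1 + j = k + (j + 1) by omega,
          show n + k - (k + (j + 1)) = n - (j + 1) by omega]
        push_cast
        ring
    · intro a ha
      rw [Finset.mem_range] at ha
      rcases eq_or_lt_of_le (Nat.lt_succ_iff.1 ha) with rfl | hlt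
      · rw [sub_self, zero_mul]
      · rw [hu (n + k - a) (by omega), mul_zero, mul_zero]
  have hQ : ∑ j ∈ Finset.range r, (((j + 1 : ℕ) : R) * u (k + (j + 1))) *
      (if j + 1 = n then ((n : R) + 1) * Q - c₀ else 0) =
      ((n : R) - k) * (((((n + k : ℕ) : R) + 1) * Q - c₀) * u (n + k)) := by
    by_cases hkn : k = 0 ∧ n = r
    · obtain ⟨rfl, rfl⟩ := hkn
      rw [Finset.sum_eq_single (n - 1), if_pos (by omega), show n - 1 + 1 = n by omega]
      · push_cast
        rw [zero_add, add_zero]; ring_nf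
      · intro j _ hj; rw [if_neg (by omega), mul_zero]
      · intro h; exact absurd (Finset.mem_range.2 (by omega)) h
    · rw [hu (n + k) (by omega), mul_zero, mul_zero]
      refine Finset.sum_eq_zero fun j hj => ?_
      rw [Finset.mem_range] at hj
      by_cases hjn : j + 1 = n
      · rw [hu (k + (j + 1)) (by omega), mul_zero, zero_mul]
      · rw [if_neg hjn, mul_zero]
  simp only [mul_sub, Finset.sum_sub_distrib]
  rw [hQ, irregularWeight, mul_sub, hA, ← h2B, hB', Finset.mul_sum]
  congr 1
  exact Finset.sum_congr rfl fun j _ => by ring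

namespace IrregularParams

open HahnModule

variable {K : Type*} [CommRing K] {r : ℕ} (p : IrregularParams K r)

theorem isUnit_natCast_laurent [Algebra ℚ K] {n : ℕ} (hn : n ≠ 0) :
    IsUnit (n : LaurentSeries K) := by
  have := (IrregularModes.isUnit_natCast (K := K) hn).map (HahnSeries.C (Γ := ℤ))
  simpa using this

/-- Reversing the columns makes the coefficient matrix triangular, with unit multiples of `c_r` on
the diagonal. -/
theorem isUnit_det_fieldMatrix [Algebra ℚ K] : IsUnit p.fieldMatrix.det := by
  have h1 : (p.fieldMatrix.submatrix id Fin.revPerm).det =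
      Equiv.Perm.sign (Fin.revPerm : Equiv.Perm (Fin r)) * p.fieldMatrix.det :=
    Matrix.det_permute' _ _
  have h2 : (p.fieldMatrix.submatrix id Fin.revPerm).det =
      ∏ i : Fin r, (((r - i : ℕ) : LaurentSeries K) * p.top) := by
    rw [Matrix.det_of_isUpperTriangular]
    · refine Finset.prod_congr rfl fun i _ => ?_
      simp only [Matrix.submatrix_apply, fieldMatrix, Matrix.of_apply, id, Fin.revPerm_apply,
        Fin.val_rev]
      rw [show r - (i + 1 : ℕ) + 1 = r - i by omega, show (i : ℕ) + (r - i) = r by omega,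
        p.upper_self]
    · intro i j hij
      simp only [id] at hij
      simp only [Matrix.submatrix_apply, fieldMatrix, Matrix.of_apply, id, Fin.revPerm_apply,
        Fin.val_rev]
      rw [p.upper_of_lt (by have : (j : ℕ) < i := hij; omega), mul_zero]
  have h3 : IsUnit (p.fieldMatrix.submatrix id Fin.revPerm).det := by
    rw [h2]
    refine IsUnit.prod_univ_iff.2 fun i => ?_
    exact (isUnit_natCast_laurent (by omega)).mul p.isUnit_top
  rw [h1] at h3
  exact isUnit_of_mul_isUnit_right h3

/-- The coefficients of `∂/∂c_r` in terms of the vector fields `𝒟_n`. -/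
noncomputable def topCoeff (hr : 2 ≤ r) (n : Fin r) : LaurentSeries K :=
  (p.fieldMatrix⁻¹) ⟨r - 1, by omega⟩ n

theorem sum_topCoeff_mul [Algebra ℚ K] (hr : 2 ≤ r) {j : ℕ} (hj : j < r) :
    ∑ n : Fin r, p.topCoeff hr n * (((j + 1 : ℕ) : LaurentSeries K) * p.upper (n + (j + 1))) =
      if j + 1 = r then 1 else 0 := by
  have h := Matrix.nonsing_inv_mul _ p.isUnit_det_fieldMatrix
  have h' := congrFun (congrFun h ⟨r - 1, by omega⟩) ⟨j, hj⟩
  rw [Matrix.mul_apply, Matrix.one_apply] at h'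
  refine Eq.trans h' ?_
  simp only [Fin.mk.injEq]
  split_ifs <;> first | rfl | omega

/-- The subring of power series in the ring of Laurent series. -/
noncomputable def integral (K : Type*) [CommRing K] : Subring (LaurentSeries K) :=
  (HahnSeries.ofPowerSeries ℤ K).range

theorem C_mem_integral (a : K) : (HahnSeries.C a : LaurentSeries K) ∈ integral K :=
  ⟨PowerSeries.C a, HahnSeries.ofPowerSeries_C a⟩

theorem top_mem_integral : p.top ∈ integral K :=
  ⟨PowerSeries.X, HahnSeries.ofPowerSeries_X⟩

theorem mem_integral_iff {f : LaurentSeries K} : f ∈ integral K ↔ ∀ n < 0, f.coeff n = 0 := by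
  constructor
  · rintro ⟨g, rfl⟩ n hn
    have := PowerSeries.coeff_coe g n
    rwa [if_pos hn] at this
  · intro h
    refine ⟨PowerSeries.mk fun n => f.coeff n, ?_⟩
    ext n
    rw [PowerSeries.coeff_coe]
    split_ifs with hn
    · exact (h n hn).symm
    · rw [PowerSeries.coeff_mk]; congr 1; omega

theorem upper_mem_integral (j : ℕ) : p.upper j ∈ integral K := by
  unfold upper
  split_ifs
  · exact p.top_mem_integral
  · exact C_mem_integral _

theorem weight_mem_integral (n : ℕ) : p.weight n ∈ integral K := by
  refine sub_mem (mul_mem (sub_mem (mul_mem (add_mem (natCast_mem _ n) (one_mem _))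
    (C_mem_integral _)) (C_mem_integral _)) (p.upper_mem_integral n)) (sum_mem fun k _ => ?_)
  exact mul_mem (p.upper_mem_integral k) (p.upper_mem_integral _)

/-- The coefficient of `𝒟_n` in `∂/∂c_r` has a pole of order at most `n + 1`, by back substitution
in the anti-triangular system. -/
theorem top_pow_mul_topCoeff_mem [Algebra ℚ K] (hr : 2 ≤ r) (n : Fin r) :
    p.top ^ ((n : ℕ) + 1) * p.topCoeff hr n ∈ integral K := by
  obtain ⟨n, hn⟩ := n
  induction n using Nat.strong_induction_on with
  | _ n ih =>
    have hs := p.sum_topCoeff_mul hr (j := r - 1 - n) (by omega)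
    rw [show r - 1 - n + 1 = r - n by omega] at hs
    simp only [mul_left_comm _ ((r - n : ℕ) : LaurentSeries K), ← Finset.mul_sum] at hs
    obtain ⟨u, hu⟩ := IrregularModes.isUnit_natCast (K := K) (d := r - n) (by omega)
    have hu' : (HahnSeries.C (↑u⁻¹ : K) : LaurentSeries K) *
        ((r - n : ℕ) : LaurentSeries K) = 1 := by
      rw [← map_natCast (HahnSeries.C (Γ := ℤ) (R := K)), ← map_mul, ← hu, Units.inv_mul, map_one]
    have hs' : ∑ i : Fin r, p.topCoeff hr i * p.upper (i + (r - n)) =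
        HahnSeries.C (↑u⁻¹ : K) * if r - n = r then 1 else 0 := by
      rw [← hs, ← mul_assoc, hu', one_mul]
    rw [← Finset.add_sum_erase _ _ (Finset.mem_univ (⟨n, hn⟩ : Fin r)),
      show n + (r - n) = r by omega, p.upper_self, ← eq_sub_iff_add_eq] at hs'
    have e : p.top ^ (n + 1) * p.topCoeff hr ⟨n, hn⟩ =
        p.top ^ n * (p.topCoeff hr ⟨n, hn⟩ * p.top) := by ring
    rw [e, hs', mul_sub, Finset.mul_sum]
    refine sub_mem (mul_mem (pow_mem p.top_mem_integral _) (mul_mem (C_mem_integral _) ?_))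
      (sum_mem fun i hi => ?_)
    · split_ifs
      · exact one_mem _
      · exact zero_mem _
    · rcases lt_or_ge n i with hlt | hge
      · rw [p.upper_of_lt (by omega), mul_zero, mul_zero]
        exact zero_mem _
      · have hne : (i : ℕ) ≠ n := fun h => (Finset.mem_erase.1 hi).1 (Fin.ext h)
        have e2 : p.top ^ n * (p.topCoeff hr i * p.upper (i + (r - n))) =
            p.top ^ (n - (i + 1)) * (p.top ^ ((i : ℕ) + 1) * p.topCoeff hr i) *
              p.upper (i + (r - n)) := by
          rw [← mul_assoc (p.top ^ (n - _)), ← pow_add,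
            show n - (i + 1) + ((i : ℕ) + 1) = n by omega, mul_assoc]
        rw [e2]
        exact mul_mem (mul_mem (pow_mem p.top_mem_integral _) (ih i (by omega) i.2))
          (p.upper_mem_integral _)

theorem top_pow_r_mul_topCoeff_mem [Algebra ℚ K] (hr : 2 ≤ r) (n : Fin r) :
    p.top ^ r * p.topCoeff hr n ∈ integral K := by
  have e : p.top ^ r * p.topCoeff hr n =
      p.top ^ (r - (n + 1)) * (p.top ^ ((n : ℕ) + 1) * p.topCoeff hr n) := by
    rw [← mul_assoc, ← pow_add, show r - (n + 1) + ((n : ℕ) + 1) = r by omega]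
  rw [e]
  exact mul_mem (pow_mem p.top_mem_integral _) (p.top_pow_mul_topCoeff_mem hr n)

/-- The derivative of `Λ_n` along `∂/∂c_r`, written with the vector fields `𝒟_k`. -/
theorem sum_topCoeff_mul_weight [Algebra ℚ K] (hr : 2 ≤ r) {n : ℕ} (hn : r ≤ n) :
    ∑ k : Fin r, p.topCoeff hr k * (((n : LaurentSeries K) - (k : ℕ)) * p.weight (n + k)) =
      HahnSeries.C (p.weightLinear n) + 2 * (p.top * HahnSeries.C (p.weightQuadratic n)) := by
  have h1 : ∀ k : Fin r, p.topCoeff hr k * (((n : LaurentSeries K) - (k : ℕ)) * p.weight (n + k)) =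
      ∑ j ∈ Finset.range r, p.topCoeff hr k *
        (((j + 1 : ℕ) : LaurentSeries K) * p.upper (k + (j + 1))) *
        ((if j + 1 = n then ((n : LaurentSeries K) + 1) * HahnSeries.C p.Q - HahnSeries.C p.c₀
          else 0) - 2 * p.upper (n - (j + 1))) := by
    intro k
    rw [weight, sub_mul_irregularWeight _ _ _ (p.upper_zero (by omega))
      (fun i hi => p.upper_of_lt hi) (by omega) hn, Finset.mul_sum]
    exact Finset.sum_congr rfl fun j _ => by ring
  simp only [h1]
  rw [Finset.sum_comm]
  simp only [← Finset.sum_mul]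
  rw [Finset.sum_eq_single (r - 1), p.sum_topCoeff_mul hr (by omega), if_pos (by omega), one_mul,
    show r - 1 + 1 = r by omega, p.upper_eq (by omega), weightLinear, weightQuadratic]
  · simp only [eq_comm (a := r) (b := n)]
    have : (n - r = r) ↔ n = 2 * r := by omega
    simp only [this]
    split_ifs with h1 h2
    · omega
    all_goals
      simp only [map_sub, map_mul, map_add, map_natCast, map_one, map_neg, map_zero, map_ofNat]
      ring
  · intro j hj hjr
    rw [p.sum_topCoeff_mul hr (Finset.mem_range.1 hj), if_neg (by omega), zero_mul]
  · intro h; exact absurd (Finset.mem_range.2 (by omega)) h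

end IrregularParams

/-! ### Scalar differential equations with an irregular singularity -/

namespace PowerSeries

variable {K : Type*} [CommRing K]

/-- The coefficients of the solution of `A' = A S` with constant term `1`. -/
noncomputable def linearODECoeff [Algebra ℚ K] (S : PowerSeries K) : ℕ → K
  | 0 => 1
  | n + 1 => algebraMap ℚ K (1 / ((n : ℚ) + 1)) *
      ∑ i : Fin (n + 1), linearODECoeff S i * coeff (n - i) S
decreasing_by exact i.2

theorem exists_linearODE [Algebra ℚ K] (S : PowerSeries K) :
    ∃ A : PowerSeries K, constantCoeff A = 1 ∧ derivative K A = A * S := by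
  refine ⟨mk (linearODECoeff S), ?_, ?_⟩
  · rw [← coeff_zero_eq_constantCoeff_apply, coeff_mk, linearODECoeff]
  · ext n
    rw [coeff_derivative, coeff_mk, linearODECoeff, coeff_mul,
      Finset.Nat.sum_antidiagonal_eq_sum_range_succ_mk, ← Fin.sum_univ_eq_sum_range
        (fun i => coeff i (mk (linearODECoeff S)) * coeff (n - i) S)]
    simp only [coeff_mk]
    have h : algebraMap ℚ K (1 / ((n : ℚ) + 1)) * ((n : K) + 1) = 1 := by
      have e : ((n : K) + 1) = algebraMap ℚ K ((n : ℚ) + 1) := by simp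
      rw [e, ← map_mul, one_div, inv_mul_cancel₀ (by positivity), map_one]
    rw [mul_comm (algebraMap ℚ K _), mul_assoc, h, mul_one]

theorem eq_zero_of_linearODE [Algebra ℚ K] {S A : PowerSeries K} (h0 : constantCoeff A = 0)
    (h : derivative K A = A * S) : A = 0 := by
  ext n
  rw [map_zero]
  induction n using Nat.strong_induction_on with
  | _ n ih =>
    rcases n with _ | n
    · rwa [coeff_zero_eq_constantCoeff_apply]
    · have hn := congrArg (coeff n) h
      rw [coeff_derivative, coeff_mul, Finset.sum_eq_zero] at hn
      · have hu : IsUnit ((n : K) + 1) := by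
          have := IrregularModes.isUnit_natCast (K := K) (Nat.succ_ne_zero n)
          simpa using this
        exact (hu.mul_left_eq_zero).1 hn
      · intro ij hij
        rw [ih ij.1 (by have := Finset.HasAntidiagonal.mem_antidiagonal.1 hij; omega), zero_mul]

/-- The polynomial `X ^ r (ν / X - ∑ k g_k / X ^ (k + 1))`, the logarithmic derivative of
`X ^ ν exp (∑ g_k / X ^ k)` multiplied by `X ^ r`; the entry of `g` with index `i` is `g_{i+1}`. -/
noncomputable def polarPart {r : ℕ} (ν : K) (g : Fin (r - 1) → K) : PowerSeries K :=
  monomial (r - 1) ν - ∑ i : Fin (r - 1), monomial (r - 2 - i) ((((i : ℕ) + 1 : ℕ) : K) * g i)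

theorem coeff_polarPart_sub_one {r : ℕ} (hr : 2 ≤ r) (ν : K) (g : Fin (r - 1) → K) :
    coeff (r - 1) (polarPart ν g) = ν := by
  rw [polarPart, map_sub, map_sum, coeff_monomial_same, Finset.sum_eq_zero, sub_zero]
  intro i _
  rw [coeff_monomial, if_neg (by omega)]

theorem coeff_polarPart {r : ℕ} (ν : K) (g : Fin (r - 1) → K) (i : Fin (r - 1)) :
    coeff (r - 2 - i) (polarPart ν g) = -((((i : ℕ) + 1 : ℕ) : K) * g i) := by
  rw [polarPart, map_sub, map_sum, coeff_monomial, if_neg (by omega), Finset.sum_eq_single i,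
    coeff_monomial_same, zero_sub]
  · intro j _ hj
    rw [coeff_monomial, if_neg]
    intro h
    exact hj (Fin.ext (by omega))
  · simp

/-- The scalar equation for the prefactor: a regular-singular perturbation of the equation
`X ^ r A' = A H` has a power series solution once the polar part of `H / X ^ r` is removed, and only
then. -/
theorem existsUnique_irregularODE [Algebra ℚ K] {r : ℕ} (hr : 2 ≤ r) (H : PowerSeries K) :
    ∃! q : K × (Fin (r - 1) → K) × PowerSeries K, constantCoeff q.2.2 = 1 ∧
      X ^ r * derivative K q.2.2 + polarPart q.1 q.2.1 * q.2.2 = q.2.2 * H := by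
  have hcancel : ∀ {f g : PowerSeries K}, X ^ r * f = X ^ r * g → f = g := by
    intro f g h
    ext n
    have := congrArg (coeff (n + r)) h
    rwa [coeff_X_pow_mul, coeff_X_pow_mul] at this
  have hunit : ∀ n : ℕ, IsUnit ((n + 1 : ℕ) : K) := fun n =>
    IrregularModes.isUnit_natCast (Nat.succ_ne_zero n)
  choose u hu using hunit
  set ν : K := coeff (r - 1) H
  set g : Fin (r - 1) → K := fun i => -((u i)⁻¹ * coeff (r - 2 - i) H : K)
  have hP : ∀ n < r, coeff n (H - polarPart ν g) = 0 := by
    intro n hn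
    rw [map_sub, sub_eq_zero]
    rcases eq_or_ne n (r - 1) with rfl | hne
    · rw [coeff_polarPart_sub_one hr]
    · obtain ⟨i, rfl⟩ : ∃ i : Fin (r - 1), n = r - 2 - i := ⟨⟨r - 2 - n, by omega⟩, by
        simp only; omega⟩
      rw [coeff_polarPart]
      simp only [g]
      rw [← hu, mul_neg, neg_neg, ← mul_assoc, Units.mul_inv, one_mul]
  obtain ⟨S, hS⟩ : X ^ r ∣ H - polarPart ν g := X_pow_dvd_iff.2 hP
  obtain ⟨A, hA0, hA⟩ := exists_linearODE S
  refine ⟨(ν, g, A), ⟨hA0, ?_⟩, ?_⟩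
  · simp only
    rw [hA, mul_left_comm, ← hS]
    ring
  · rintro ⟨ν', g', B⟩ ⟨hB0, hB⟩
    simp only at hB0 hB
    have hBu : IsUnit B := isUnit_iff_constantCoeff.2 (hB0 ▸ isUnit_one)
    have hdvd : X ^ r ∣ H - polarPart ν' g' := by
      obtain ⟨b, rfl⟩ := hBu
      refine ⟨(↑b⁻¹ : PowerSeries K) * derivative K (b : PowerSeries K), ?_⟩
      have h1 : H - polarPart ν' g' =
          (↑b⁻¹ : PowerSeries K) * ((b : PowerSeries K) * H - polarPart ν' g' * b) := by
        rw [mul_sub, mul_comm (polarPart ν' g'), ← mul_assoc, ← mul_assoc, Units.inv_mul, one_mul,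
          one_mul]
      rw [h1, ← hB]
      ring
    have hcoef := X_pow_dvd_iff.1 hdvd
    have hν : ν' = ν := by
      have := hcoef (r - 1) (by omega)
      rw [map_sub, sub_eq_zero, coeff_polarPart_sub_one hr] at this
      exact this.symm
    have hg : g' = g := by
      funext i
      have := hcoef (r - 2 - i) (by omega)
      rw [map_sub, sub_eq_zero, coeff_polarPart] at this
      simp only [g]
      rw [this, ← hu, mul_neg, neg_neg, ← mul_assoc, Units.inv_mul, one_mul]
    subst hν hg
    have hBS : derivative K B = B * S := by
      refine hcancel ?_
      rw [mul_left_comm, ← hS, mul_sub, ← hB]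
      ring
    have hsub : A - B = 0 := eq_zero_of_linearODE (S := S) (by rw [map_sub, hA0, hB0, sub_self])
      (by rw [map_sub, hA, hBS, sub_mul])
    rw [sub_eq_zero.1 hsub]

end PowerSeries

/-! ### The deformation problem -/

namespace IrregularModes

open HahnModule

section

variable {K V : Type*} [CommRing K] [AddCommGroup V] [Module K V]

theorem coeff_weight_smul {r : ℕ} (p : IrregularParams K r) (hr : 2 ≤ r) {n : ℕ} (hn : r ≤ n)
    (F : HahnModule ℤ K V) (m : ℤ) :
    ((of K).symm (p.weight n • F)).coeff m = p.lowerWeight n • ((of K).symm F).coeff m +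
      p.weightLinear n • ((of K).symm F).coeff (m - 1) +
      p.weightQuadratic n • ((of K).symm F).coeff (m - 2) := by
  have e1 : ∀ a : K, p.top * HahnSeries.C a = HahnSeries.single 1 a := fun a => by
    rw [IrregularParams.top, HahnSeries.C_apply, HahnSeries.single_mul_single]; simp
  have e2 : ∀ a : K, p.top ^ 2 * HahnSeries.C a = HahnSeries.single 2 a := fun a => by
    rw [IrregularParams.top, HahnSeries.C_apply, HahnSeries.single_pow,
      HahnSeries.single_mul_single]; simp
  rw [p.weight_eq (by omega) hn, e1, e2, _root_.add_smul, _root_.add_smul, of_symm_add,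
    of_symm_add, HahnSeries.coeff_add, HahnSeries.coeff_add, coeff_C_smul, coeff_single_smul,
    coeff_single_smul]

/-- The power series with the given coefficients. -/
noncomputable def ofCoeffs (v : ℕ → V) : HahnModule ℤ K V :=
  of K (HahnSeries.ofSuppBddBelow (fun n : ℤ => if 0 ≤ n then v n.toNat else 0)
    ⟨0, fun n hn => by
      by_contra h
      exact hn (if_neg h)⟩)

theorem coeff_ofCoeffs (v : ℕ → V) (n : ℤ) :
    ((of K).symm (ofCoeffs (K := K) v)).coeff n = if 0 ≤ n then v n.toNat else 0 := rfl

theorem ofCoeffs_coeff {F : HahnModule ℤ K V} (hF : ∀ n < 0, ((of K).symm F).coeff n = 0) :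
    ofCoeffs (K := K) (fun n => ((of K).symm F).coeff n) = F := by
  refine ext_coeff fun n => ?_
  rw [coeff_ofCoeffs]
  split_ifs with h
  · congr 1; omega
  · exact (hF n (by omega)).symm

theorem coeff_smul_of_neg {f : LaurentSeries K} (hf : f ∈ IrregularParams.integral K)
    {F : HahnModule ℤ K V} (hF : ∀ n < 0, ((of K).symm F).coeff n = 0) {n : ℤ} (hn : n < 0) :
    ((of K).symm (f • F)).coeff n = 0 := by
  rw [coeff_smul]
  refine Finset.sum_eq_zero fun ij h => ?_
  have h' : ij.1 + ij.2 = n := ((Finset.mem_vaddAntidiagonal _ _).1 h).2.2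
  rcases lt_or_ge ij.1 0 with h1 | h1
  · rw [IrregularParams.mem_integral_iff.1 hf _ h1, zero_smul]
  · rw [hF ij.2 (by omega), smul_zero]

end

variable {K V : Type*} [CommRing K] [Algebra ℚ K] [AddCommGroup V] [Module K V]
  (S : IrregularModes K V) {r : ℕ} (p : IrregularParams K r)

/-- The action of `L_n` on series. -/
noncomputable def series (n : ℤ) (F : HahnModule ℤ K V) : HahnModule ℤ K V :=
  mapCoeff (S.mode n) F

theorem coeff_series (n : ℤ) (F : HahnModule ℤ K V) (m : ℤ) :
    ((of K).symm (S.series n F)).coeff m = S.mode n (((of K).symm F).coeff m) := rfl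

theorem series_smul (n : ℤ) (f : LaurentSeries K) (F : HahnModule ℤ K V) :
    S.series n (f • F) = f • S.series n F :=
  mapCoeff_smul_linear (S.mode n) f F

theorem series_sub (n : ℤ) (F G : HahnModule ℤ K V) :
    S.series n (F - G) = S.series n F - S.series n G :=
  mapCoeff_sub (S.mode n) F G

theorem series_sum {ι : Type*} (n : ℤ) (s : Finset ι) (F : ι → HahnModule ℤ K V) :
    S.series n (∑ i ∈ s, F i) = ∑ i ∈ s, S.series n (F i) :=
  mapCoeff_sum (S.mode n) s F

theorem series_theta (n : ℤ) (F : HahnModule ℤ K V) :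
    S.series n (theta F) = theta (S.series n F) :=
  (theta_mapCoeff (S.mode n) F).symm

theorem series_series {n k : ℤ} (h : n + k ≠ 0) (F : HahnModule ℤ K V) :
    S.series n (S.series k F) = S.series k (S.series n F) +
      ((n : LaurentSeries K) - (k : LaurentSeries K)) • S.series (n + k) F := by
  refine ext_coeff fun m => ?_
  have e : ((n : LaurentSeries K) - (k : LaurentSeries K)) = HahnSeries.C ((n - k : ℤ) : K) := by
    rw [map_intCast]; push_cast; ring
  rw [of_symm_add, HahnSeries.coeff_add, e, coeff_C_smul]
  simp only [coeff_series]
  rw [S.comm, if_neg h, zero_smul, add_zero]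

/-- The operators `D_0 = L_0 - Δ` and `D_n = L_n - Λ_n` on series. -/
noncomputable def seriesD (n : ℕ) (F : HahnModule ℤ K V) : HahnModule ℤ K V :=
  S.series n F - (if n = 0 then HahnSeries.C p.Δ else p.weight n) • F

/-- The operator `L_*` on series. -/
noncomputable def seriesLstar (hr : 2 ≤ r) (F : HahnModule ℤ K V) : HahnModule ℤ K V :=
  p.top ^ r • ∑ n : Fin r, p.topCoeff hr n • S.seriesD p n F

/-- The operator `L_* - c_r^r ∂/∂c_r` on series. -/
noncomputable def connection (hr : 2 ≤ r) (F : HahnModule ℤ K V) : HahnModule ℤ K V :=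
  S.seriesLstar p hr F - p.top ^ (r - 1) • theta F

theorem seriesD_smul (n : ℕ) (f : LaurentSeries K) (F : HahnModule ℤ K V) :
    S.seriesD p n (f • F) = f • S.seriesD p n F := by
  rw [seriesD, seriesD, series_smul, _root_.smul_sub, smul_comm f]

theorem seriesLstar_smul (hr : 2 ≤ r) (f : LaurentSeries K) (F : HahnModule ℤ K V) :
    S.seriesLstar p hr (f • F) = f • S.seriesLstar p hr F := by
  rw [seriesLstar, seriesLstar, smul_comm f, Finset.smul_sum]
  simp only [seriesD_smul, smul_comm _ f, Finset.smul_sum]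

theorem connection_smul (hr : 2 ≤ r) (f : LaurentSeries K) (F : HahnModule ℤ K V) :
    S.connection p hr (f • F) =
      f • S.connection p hr F - (p.top ^ (r - 1) * thetaScalar f) • F := by
  rw [connection, connection, seriesLstar_smul, theta_smul, _root_.smul_add, _root_.smul_sub,
    smul_comm f (p.top ^ _), mul_smul]
  abel

/-- The operator `L_* - c_r^r ∂/∂c_r` preserves the equations `L_n F = Λ_n F`. -/
theorem series_connection (hr : 2 ≤ r) {F : HahnModule ℤ K V}
    (hF : ∀ n : ℕ, r ≤ n → S.series n F = p.weight n • F) {n : ℕ} (hn : r ≤ n) :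
    S.series n (S.connection p hr F) = p.weight n • S.connection p hr F := by
  have hD : ∀ k : Fin r, p.topCoeff hr k • S.series n (S.seriesD p k F) =
      p.weight n • p.topCoeff hr k • S.seriesD p k F +
      (p.topCoeff hr k * (((n : LaurentSeries K) - (k : ℕ)) * p.weight (n + k))) • F := by
    intro k
    have h1 : S.series ((n : ℤ) + (k : ℕ)) F = p.weight (n + k) • F := by
      have := hF (n + k) (by omega)
      rwa [Nat.cast_add] at this
    rw [seriesD, series_sub, series_smul, S.series_series (by omega), h1, hF n hn, series_smul]
    simp only [Int.cast_natCast]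
    generalize (n : LaurentSeries K) - (k : ℕ) = a
    simp only [_root_.smul_sub, _root_.smul_add, smul_smul]
    rw [mul_left_comm (p.weight n), mul_comm (p.weight n) (p.topCoeff hr k),
      mul_comm (ite _ _ _) (p.weight n)]
    abel
  rw [connection, series_sub, seriesLstar, series_smul, series_smul, series_sum]
  simp only [series_smul]
  rw [Finset.sum_congr rfl fun k _ => hD k, Finset.sum_add_distrib, ← Finset.sum_smul,
    p.sum_topCoeff_mul_weight hr hn, ← Finset.smul_sum, series_theta, hF n hn, theta_smul,
    p.thetaScalar_weight (by omega) hn]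
  have e : p.top ^ r = p.top ^ (r - 1) * p.top := by
    rw [← pow_succ, show r - 1 + 1 = r by omega]
  have e' : p.top * HahnSeries.C (p.weightLinear n) +
      2 * (p.top ^ 2 * HahnSeries.C (p.weightQuadratic n)) =
      p.top * (HahnSeries.C (p.weightLinear n) +
        2 * (p.top * HahnSeries.C (p.weightQuadratic n))) := by ring
  rw [e, e']
  generalize HahnSeries.C (p.weightLinear n) +
        2 * (p.top * HahnSeries.C (p.weightQuadratic n)) = a
  simp only [_root_.smul_sub, _root_.smul_add, smul_smul]
  rw [mul_comm (p.weight n), mul_comm (p.weight n), mul_assoc (p.top ^ (r - 1)),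
    mul_assoc (p.top ^ (r - 1))]
  abel

/-- The data entering the deformation problem: an irregular module of rank `r - 1` with the
eigenvalues prescribed by the parameters, all of whose vectors have finite weight, with a constant
term functional. -/
structure IsVermaLike (ε : V →ₗ[K] K) : Prop where
  two_le : 2 ≤ r
  s_eq : S.s = r - 1
  eig_eq : S.eig = p.lowerWeight
  fin : ∀ x, ∃ d : ℕ, x ∈ S.filt d
  map_vac : ε S.vac = 1

namespace IsVermaLike

variable {S p} {ε : V →ₗ[K] K}

/-- A series satisfying `L_n F = Λ_n F` is determined by its constant term. -/
theorem eq_zero_of_series_eq (hS : S.IsVermaLike p ε) {F : HahnModule ℤ K V}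
    (hF : ∀ n : ℕ, r ≤ n → n ≤ 2 * r → S.series n F = p.weight n • F)
    (hε : evalCoeff ε F = 0) : F = 0 := by
  have hr := hS.two_le
  have hs := hS.s_eq
  by_contra hne
  obtain ⟨m, hm, hlt⟩ := exists_coeff_ne_zero hne
  refine hm (S.eq_zero_of_lower_eq_zero hS.fin ε hS.map_vac (fun j h1 h2 => ?_) ?_)
  · have h := congrArg (fun F : HahnModule ℤ K V => ((of K).symm F).coeff m)
      (hF (S.s + j) (by omega) (by omega))
    beta_reduce at h
    rw [coeff_series, coeff_weight_smul p hr (by omega), hlt (m - 1) (by omega),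
      hlt (m - 2) (by omega), smul_zero, smul_zero, add_zero, add_zero] at h
    rw [lower_apply, h, hS.eig_eq, sub_self]
  · have h := congrArg (fun f : LaurentSeries K => f.coeff m) hε
    simpa only [coeff_evalCoeff, HahnSeries.coeff_zero] using h

/-- The normalized solution of the equations `L_n G = Λ_n G`, `n ≥ r`. -/
theorem exists_solution (hS : S.IsVermaLike p ε) :
    ∃ G : HahnModule ℤ K V,
    (∀ n < 0, ((of K).symm G).coeff n = 0) ∧ ((of K).symm G).coeff 0 = S.vac ∧
    evalCoeff ε G = 1 ∧ ∀ n : ℕ, r ≤ n → S.series n G = p.weight n • G := by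
  have hr := hS.two_le
  have hs := hS.s_eq
  obtain ⟨v, hv0, hvε, hv⟩ := S.exists_deformation hS.fin ε hS.map_vac
    (fun j => p.weightLinear (S.s + j)) (fun j => p.weightQuadratic (S.s + j))
    (fun j hj => p.weightLinear_of_lt (by omega) (by omega))
    (fun j hj => p.weightQuadratic_of_lt (by omega))
  refine ⟨ofCoeffs (K := K) v, fun n hn => ?_, hv0, ?_, fun n hn => ?_⟩
  · rw [coeff_ofCoeffs, if_neg (by omega)]
  · ext n
    rw [coeff_evalCoeff, coeff_ofCoeffs, HahnSeries.coeff_one]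
    rcases lt_trichotomy n 0 with h | rfl | h
    · rw [if_neg (by omega), if_neg (by omega), map_zero]
    · rw [if_pos le_rfl, if_pos rfl, Int.toNat_zero, hv0, hS.map_vac]
    · rw [if_pos h.le, if_neg (by omega), show n.toNat = n.toNat - 1 + 1 by omega, hvε]
  · obtain ⟨j, rfl⟩ : ∃ j, n = S.s + j := ⟨n - S.s, by omega⟩
    have hj := hv j (by omega)
    have hT : ∀ x, S.mode ((S.s + j : ℕ) : ℤ) x =
        S.lower j x + p.lowerWeight (S.s + j) • x := fun x => by
      rw [mode_eq_lower_add, hS.eig_eq]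
    refine ext_coeff fun m => ?_
    rw [coeff_series, coeff_weight_smul p hr hn, hT]
    simp only [coeff_ofCoeffs]
    rcases lt_trichotomy m 0 with h | rfl | h
    · rw [if_neg (by omega), if_neg (by omega), if_neg (by omega)]; simp
    · rw [if_pos le_rfl, if_neg (by omega), if_neg (by omega), Int.toNat_zero, hj.1]; simp
    · rcases eq_or_ne m 1 with rfl | h1
      · rw [if_pos (by omega), if_pos (by omega), if_neg (by omega)]
        simp only [Int.toNat_one, sub_self, Int.toNat_zero]
        rw [hj.2.1, smul_zero, add_zero, add_comm]
      · obtain ⟨k, rfl⟩ : ∃ k : ℕ, m = k + 2 := ⟨(m - 2).toNat, by omega⟩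
        rw [if_pos (by omega), if_pos (by omega), if_pos (by omega),
          show ((k : ℤ) + 2).toNat = k + 2 by omega,
          show ((k : ℤ) + 2 - 1).toNat = k + 1 by omega,
          show ((k : ℤ) + 2 - 2).toNat = k by omega, hj.2.2 k]
        abel

/-- The solutions of the equations `L_n F = Λ_n F` are the scalar multiples of the normalized one.
-/
theorem eq_evalCoeff_smul (hS : S.IsVermaLike p ε) {F G : HahnModule ℤ K V} (hG : evalCoeff ε G = 1)
    (hG' : ∀ n : ℕ, r ≤ n → S.series n G = p.weight n • G)
    (hF : ∀ n : ℕ, r ≤ n → n ≤ 2 * r → S.series n F = p.weight n • F) :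
    F = evalCoeff ε F • G := by
  rw [← sub_eq_zero]
  refine hS.eq_zero_of_series_eq (fun n h1 h2 => ?_) ?_
  · rw [series_sub, series_smul, hF n h1 h2, hG' n h1, _root_.smul_sub, smul_comm (p.weight n)]
  · rw [evalCoeff_sub, evalCoeff_smul, hG, mul_one, sub_self]

/-- The factor `c_r ^ r` in `L_*` cancels the poles of the coefficients of the vector fields. -/
theorem evalCoeff_connection_mem (hS : S.IsVermaLike p ε) {G : HahnModule ℤ K V}
    (hG : ∀ n < 0, ((of K).symm G).coeff n = 0) :
    evalCoeff ε (S.connection p hS.two_le G) ∈ IrregularParams.integral K := by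
  have hmem : ∀ F : HahnModule ℤ K V, (∀ n < 0, ((of K).symm F).coeff n = 0) →
      evalCoeff ε F ∈ IrregularParams.integral K := fun F hF =>
    IrregularParams.mem_integral_iff.2 fun n hn => by rw [coeff_evalCoeff, hF n hn, map_zero]
  rw [connection, seriesLstar, evalCoeff_sub, evalCoeff_smul, evalCoeff_smul, evalCoeff_sum,
    Finset.mul_sum]
  refine sub_mem (sum_mem fun k _ => ?_) (mul_mem (pow_mem p.top_mem_integral _)
    (hmem _ fun n hn => by rw [coeff_theta, hG n hn, smul_zero]))
  rw [evalCoeff_smul, ← mul_assoc, seriesD, evalCoeff_sub, evalCoeff_smul]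
  refine mul_mem (p.top_pow_r_mul_topCoeff_mem _ k) (sub_mem
    (hmem _ fun n hn => by rw [coeff_series, hG n hn, map_zero]) (mul_mem ?_ (hmem _ hG)))
  split_ifs
  · exact IrregularParams.C_mem_integral _
  · exact p.weight_mem_integral _

/-- Existence and uniqueness of the series of the required form satisfying all the equations. The
solutions of the equations for `L_n`, `n ≥ r`, form a free module of rank one over the scalar
series, and the remaining equation is a scalar differential equation on it. -/
theorem existsUnique_canonical (hS : S.IsVermaLike p ε) : ∃! q : K × (Fin (r - 1) → K) × (ℕ → V),
    q.2.2 0 = S.vac ∧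
    S.connection p hS.two_le (ofCoeffs (K := K) q.2.2) =
      HahnSeries.ofPowerSeries ℤ K (PowerSeries.polarPart q.1 q.2.1) •
        ofCoeffs (K := K) q.2.2 ∧
    ∀ n : ℕ, r ≤ n → n ≤ 2 * r → S.series n (ofCoeffs (K := K) q.2.2) =
      p.weight n • ofCoeffs (K := K) q.2.2 := by
  have hr := hS.two_le
  obtain ⟨G, hneg, hvac, hG, hGL⟩ := hS.exists_solution
  obtain ⟨H, hH⟩ := hS.evalCoeff_connection_mem hneg
  have hconn : S.connection p hr G = HahnSeries.ofPowerSeries ℤ K H • G := by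
    have h1 := hS.eq_evalCoeff_smul hG hGL (F := S.connection p hr G)
      fun n hn _ => S.series_connection p hr hGL hn
    rwa [← hH] at h1
  have htop : p.top = HahnSeries.ofPowerSeries ℤ K PowerSeries.X :=
    HahnSeries.ofPowerSeries_X.symm
  have htheta : ∀ A : PowerSeries K, thetaScalar (HahnSeries.ofPowerSeries ℤ K A) =
      HahnSeries.ofPowerSeries ℤ K (PowerSeries.X * PowerSeries.derivative K A) := by
    intro A
    ext n
    rw [coeff_thetaScalar, PowerSeries.coeff_coe, PowerSeries.coeff_coe]
    split_ifs with hn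
    · rw [smul_zero]
    · obtain ⟨k, rfl⟩ : ∃ k : ℕ, n = k := ⟨n.toNat, by omega⟩
      rw [Int.natAbs_natCast, natCast_zsmul]
      rcases k with _ | k
      · simp
      · rw [PowerSeries.coeff_succ_X_mul, PowerSeries.coeff_derivative, nsmul_eq_mul, mul_comm]
        push_cast; ring
  have hinj : ∀ f g : LaurentSeries K, f • G = g • G → f = g := by
    intro f g h
    have := congrArg (evalCoeff ε) h
    rwa [evalCoeff_smul, evalCoeff_smul, hG, mul_one, mul_one] at this
  -- the operator acts on multiples of `G` as a scalar differential operator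
  have hiff : ∀ (A : PowerSeries K) (ν : K) (g : Fin (r - 1) → K),
      S.connection p hr (HahnSeries.ofPowerSeries ℤ K A • G) =
        HahnSeries.ofPowerSeries ℤ K (PowerSeries.polarPart ν g) •
          HahnSeries.ofPowerSeries ℤ K A • G ↔
      PowerSeries.X ^ r * PowerSeries.derivative K A + PowerSeries.polarPart ν g * A = A * H := by
    intro A ν g
    have e : S.connection p hr (HahnSeries.ofPowerSeries ℤ K A • G) =
        HahnSeries.ofPowerSeries ℤ K
          (A * H - PowerSeries.X ^ r * PowerSeries.derivative K A) • G := by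
      rw [connection_smul, hconn, htheta, htop, ← map_pow, ← map_mul, ← mul_assoc, ← pow_succ,
        show r - 1 + 1 = r by omega, smul_smul, ← map_mul, ← _root_.sub_smul, ← map_sub]
    rw [e, smul_smul, ← map_mul]
    constructor
    · intro h
      have := HahnSeries.ofPowerSeries_injective (hinj _ _ h)
      rw [← this]; ring
    · intro h
      rw [← h, add_sub_cancel_left]
  obtain ⟨⟨ν, g, A⟩, ⟨hA0, hA⟩, huniq⟩ := PowerSeries.existsUnique_irregularODE hr H
  have hAneg : ∀ n < 0, ((of K).symm (HahnSeries.ofPowerSeries ℤ K A • G)).coeff n = 0 :=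
    fun n hn => coeff_smul_of_neg ⟨A, rfl⟩ hneg hn
  refine ⟨(ν, g, fun n : ℕ => ((of K).symm (HahnSeries.ofPowerSeries ℤ K A • G)).coeff n),
    ⟨?_, ?_, ?_⟩, ?_⟩
  · obtain ⟨B, hB⟩ : PowerSeries.X ∣ A - 1 := by
      rw [PowerSeries.X_dvd_iff, map_sub, hA0, map_one, sub_self]
    have hA' : A = 1 + PowerSeries.X * B := by rw [← hB]; ring
    simp only [Nat.cast_zero]
    rw [hA', map_add, map_one, map_mul, ← htop, _root_.add_smul, one_smul, mul_smul, of_symm_add,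
      HahnSeries.coeff_add, hvac, IrregularParams.top, coeff_single_smul,
      coeff_smul_of_neg ⟨B, rfl⟩ hneg (by omega), smul_zero, add_zero]
  · simp only
    rw [ofCoeffs_coeff hAneg, hiff]
    exact hA
  · intro n h1 _
    simp only
    rw [ofCoeffs_coeff hAneg, series_smul, hGL n h1, smul_comm]
  · rintro ⟨ν', g', v⟩ ⟨hv0, hvc, hvL⟩
    simp only at hv0 hvc hvL
    have hF := hS.eq_evalCoeff_smul hG hGL hvL
    obtain ⟨B, hB⟩ : evalCoeff ε (ofCoeffs (K := K) v) ∈ IrregularParams.integral K :=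
      IrregularParams.mem_integral_iff.2 fun n hn => by
        rw [coeff_evalCoeff, coeff_ofCoeffs, if_neg (by omega), map_zero]
    have hB0 : PowerSeries.constantCoeff B = 1 := by
      have h0 := congrArg (fun f : LaurentSeries K => f.coeff 0) hB
      simp only [coeff_evalCoeff, coeff_ofCoeffs] at h0
      rw [PowerSeries.coeff_coe, if_neg (by omega), if_pos le_rfl, Int.toNat_zero, hv0,
        hS.map_vac] at h0
      simpa using h0
    change HahnSeries.ofPowerSeries ℤ K B = _ at hB
    rw [← hB] at hF
    rw [hF, hiff] at hvc
    have := huniq (ν', g', B) ⟨hB0, hvc⟩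
    simp only [Prod.mk.injEq] at this
    obtain ⟨rfl, rfl, rfl⟩ := this
    simp only [Prod.mk.injEq, true_and]
    funext n
    rw [← hF, coeff_ofCoeffs, if_pos (by omega), Int.toNat_natCast]

end IsVermaLike

end IrregularModes

/-! ### Canonical series in the irregular Verma module -/

namespace IrregularModes

variable {K V : Type*} [CommRing K] [AddCommGroup V] [Module K V]

theorem top_pow_smul_add {r : ℕ} {p : IrregularParams K r} (hr : 1 ≤ r) {F G : HahnModule ℤ K V}
    (hG : p.top • G = HahnModule.theta F) (f : LaurentSeries K) :
    p.top ^ r • (G + f • F) = p.top ^ (r - 1) • HahnModule.theta F + (p.top ^ r * f) • F := by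
  have e : p.top ^ r = p.top ^ (r - 1) * p.top := by
    rw [← pow_succ, show r - 1 + 1 = r by omega]
  rw [smul_add, smul_smul, ← hG, smul_smul, ← e]

end IrregularModes

namespace IrregularParams

open HahnModule

variable {K : Type*} [CommRing K] [Algebra ℚ K] {r : ℕ} (p : IrregularParams K r)

theorem isVermaLike_modes (hr : 2 ≤ r) (hu : IsUnit (p.lower (r - 1))) :
    (p.modes hr hu).IsVermaLike p (p.constFunctional hr) where
  two_le := hr
  s_eq := rfl
  eig_eq := rfl
  fin := (p.modes hr hu).exists_mem_filt fun _ h0 h => p.eq_top_of_genU_smul_mem h0 h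
  map_vac := p.constFunctional_vac hr

theorem Lstar_eq_seriesLstar (hr : 2 ≤ r) (hu : IsUnit (p.lower (r - 1))) (F : p.VermaSeries) :
    p.Lstar hr F = (p.modes hr hu).seriesLstar p hr F := rfl

theorem top_smul_formalDeriv (F : HahnModule ℤ K p.Verma) :
    p.top • p.formalDeriv F = theta (K := K) (V := p.Verma) F := by
  refine ext_coeff fun n => ?_
  refine (coeff_single_smul 1 (1 : K) (p.formalDeriv F : HahnModule ℤ K p.Verma) n).trans ?_
  rw [one_smul, coeff_theta]
  refine (LaurentSeries.hasseDeriv_coeff (R := K) (V := p.Verma) 1 ((of K).symm F) (n - 1)).trans ?_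
  rw [Nat.cast_one, sub_add_cancel, Ring.choose_one_right]

end IrregularParams

namespace IrregularSeries

open HahnModule IrregularParams

variable {K : Type*} [CommRing K] [Algebra ℚ K] {r : ℕ} {p : IrregularParams K r}

theorem top_pow_mul_logDeriv (hr : 2 ≤ r) (W : IrregularSeries p) :
    p.top ^ r * W.logDeriv = HahnSeries.ofPowerSeries ℤ K (PowerSeries.polarPart W.ν W.g) := by
  have hmon : ∀ (n : ℕ) (a : K), HahnSeries.ofPowerSeries ℤ K (PowerSeries.monomial n a) =
      HahnSeries.single (n : ℤ) a := by
    intro n a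
    ext m
    rw [PowerSeries.coeff_coe, HahnSeries.coeff_single]
    split_ifs with h1 h2 h2
    · omega
    · rfl
    · rw [PowerSeries.coeff_monomial, if_pos (by omega)]
    · rw [PowerSeries.coeff_monomial, if_neg (by omega)]
  rw [logDeriv, PowerSeries.polarPart, mul_sub, map_sub, hmon, map_sum, Finset.mul_sum,
    IrregularParams.top, HahnSeries.single_pow, one_pow, HahnSeries.single_mul_single, one_mul]
  congr 1
  · congr 2
    rw [nsmul_eq_mul]; omega
  · refine Finset.sum_congr rfl fun i _ => ?_
    rw [hmon, HahnSeries.single_mul_single, one_mul]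
    congr 2
    rw [nsmul_eq_mul]; omega

theorem top_pow_smul_partialTop (hr : 2 ≤ r) (W : IrregularSeries p)
    (F : HahnModule ℤ K p.Verma) :
    p.top ^ r • W.partialTop F = (p.top ^ (r - 1) • theta (K := K) (V := p.Verma) F +
      HahnSeries.ofPowerSeries ℤ K (PowerSeries.polarPart W.ν W.g) • F :
        HahnModule ℤ K p.Verma) := by
  rw [← top_pow_mul_logDeriv hr]
  exact IrregularModes.top_pow_smul_add (by omega) (p.top_smul_formalDeriv F) _

/-- The conditions on the formal vector, with the terms of the differential equation that involve
the unknown exponents collected in the polar part. -/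
theorem isCanonical_iff (hr : 2 ≤ r) (hu : IsUnit (p.lower (r - 1))) (W : IrregularSeries p) :
    W.IsCanonical hr ↔ W.v 0 = (p.modes hr hu).vac ∧
      (p.modes hr hu).connection p hr (IrregularModes.ofCoeffs (K := K) W.v) =
        HahnSeries.ofPowerSeries ℤ K (PowerSeries.polarPart W.ν W.g) •
          IrregularModes.ofCoeffs (K := K) W.v ∧
      ∀ n : ℕ, r ≤ n → n ≤ 2 * r →
        (p.modes hr hu).series n (IrregularModes.ofCoeffs (K := K) W.v) =
          p.weight n • IrregularModes.ofCoeffs (K := K) W.v := by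
  have h1 : p.Lstar hr W.body = p.top ^ r • W.partialTop W.body ↔
      (p.modes hr hu).connection p hr (IrregularModes.ofCoeffs (K := K) W.v) =
        HahnSeries.ofPowerSeries ℤ K (PowerSeries.polarPart W.ν W.g) •
          IrregularModes.ofCoeffs (K := K) W.v := by
    rw [top_pow_smul_partialTop hr, p.Lstar_eq_seriesLstar hr hu, IrregularModes.connection,
      sub_eq_iff_eq_add']
    rfl
  exact ⟨fun h => ⟨h.leading, h1.1 h.lstar, h.higher⟩, fun h => ⟨h.1, h1.2 h.2.1, h.2.2⟩⟩

theorem existsUnique_isCanonical (hr : 2 ≤ r) (hu : IsUnit (p.lower (r - 1))) :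
    ∃! W : IrregularSeries p, W.IsCanonical hr := by
  obtain ⟨⟨ν, g, v⟩, h, huniq⟩ := (p.isVermaLike_modes hr hu).existsUnique_canonical
  refine ⟨⟨ν, g, v⟩, (isCanonical_iff hr hu _).2 h, fun W hW => ?_⟩
  have := huniq (W.ν, W.g, W.v) ((isCanonical_iff hr hu W).1 hW)
  simp only [Prod.mk.injEq] at this
  obtain ⟨rfl, rfl, rfl⟩ := this
  rfl

end IrregularSeries

/-! ### Base change -/

namespace IrregularParams

attribute [local instance] LieRing.ofAssociativeRing

open HahnModule

variable {R K : Type*} [CommRing R] [CommRing K] {r : ℕ}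

/-- The image of the parameters under a ring homomorphism. -/
def map (φ : R →+* K) (p : IrregularParams R r) : IrregularParams K r where
  centralCharge := φ p.centralCharge
  Q := φ p.Q
  Δ := φ p.Δ
  c₀' := φ p.c₀'
  c₀ := φ p.c₀
  c i := φ (p.c i)

variable (φ : R →+* K) (p : IrregularParams R r)

theorem map_irregularWeight {A B : Type*} [CommRing A] [CommRing B] (f : A →+* B) (Q c₀ : A)
    (c : ℕ → A) (n : ℕ) : f (irregularWeight Q c₀ c n) =
      irregularWeight (f Q) (f c₀) (fun j => f (c j)) n := by
  simp only [irregularWeight, map_sub, map_mul, map_add, map_natCast, map_one, map_sum]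

theorem lower_map (j : ℕ) : (p.map φ).lower j = φ (p.lower j) := by
  unfold lower
  split_ifs
  · rfl
  · exact (map_zero φ).symm

theorem lowerWeight_map (n : ℕ) : (p.map φ).lowerWeight n = φ (p.lowerWeight n) := by
  rw [lowerWeight, lowerWeight, map_irregularWeight,
    show (p.map φ).lower = fun j => φ (p.lower j) from funext (lower_map φ p)]
  rfl

/-- The homomorphism of rings of Laurent series induced by a homomorphism of the coefficients. -/
noncomputable def laurentMap : LaurentSeries R →+* LaurentSeries K where
  toFun f := f.map φ
  map_one' := HahnSeries.map_one φ.toMonoidWithZeroHom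
  map_mul' _ _ := HahnSeries.map_mul (φ : R →ₙ+* K)
  map_zero' := HahnSeries.map_zero (φ : ZeroHom R K)
  map_add' _ _ := HahnSeries.map_add (φ : R →+ K)

theorem laurentMap_C (a : R) : laurentMap φ (HahnSeries.C a) = HahnSeries.C (φ a) :=
  HahnSeries.map_C a φ

theorem laurentMap_top : laurentMap φ p.top = (p.map φ).top := by
  refine (HahnSeries.map_single (φ : ZeroHom R K)).trans ?_
  rw [top]
  congr 1
  exact map_one φ

theorem laurentMap_upper (j : ℕ) : laurentMap φ (p.upper j) = (p.map φ).upper j := by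
  rw [upper, upper, apply_ite (laurentMap φ), laurentMap_top, laurentMap_C, lower_map]

theorem laurentMap_weight (n : ℕ) : laurentMap φ (p.weight n) = (p.map φ).weight n := by
  rw [weight, map_irregularWeight, laurentMap_C, laurentMap_C, weight,
    show (p.map φ).upper = fun j => laurentMap φ (p.upper j) from
      funext fun j => (laurentMap_upper φ p j).symm]
  rfl

theorem laurentMap_ofPowerSeries (f : PowerSeries R) :
    laurentMap φ (HahnSeries.ofPowerSeries ℤ R f) =
      HahnSeries.ofPowerSeries ℤ K (PowerSeries.map φ f) := by
  ext n
  change φ ((HahnSeries.ofPowerSeries ℤ R f).coeff n) = _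
  rw [PowerSeries.coeff_coe, PowerSeries.coeff_coe]
  split_ifs
  · exact map_zero φ
  · rw [PowerSeries.coeff_map]

theorem map_polarPart (ν : R) (g : Fin (r - 1) → R) :
    PowerSeries.map φ (PowerSeries.polarPart ν g) =
      PowerSeries.polarPart (φ ν) (fun i => φ (g i)) := by
  have h : ∀ (n : ℕ) (a : R), PowerSeries.map φ (PowerSeries.monomial n a) =
      PowerSeries.monomial n (φ a) := fun n a => by
    ext m
    rw [PowerSeries.coeff_map, PowerSeries.coeff_monomial, PowerSeries.coeff_monomial,
      apply_ite φ, map_zero]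
  simp only [PowerSeries.polarPart, map_sub, map_sum, h, map_mul, map_natCast]

theorem laurentMap_topCoeff [Algebra ℚ R] (hr : 2 ≤ r) (n : Fin r) :
    laurentMap φ (p.topCoeff hr n) = (p.map φ).topCoeff hr n := by
  have h : (laurentMap φ).mapMatrix p.fieldMatrix = (p.map φ).fieldMatrix := by
    ext1 i j
    simp only [RingHom.mapMatrix_apply, Matrix.map_apply, fieldMatrix, Matrix.of_apply, map_mul,
      map_natCast, laurentMap_upper]
  have h' : (laurentMap φ).mapMatrix p.fieldMatrix⁻¹ = (p.map φ).fieldMatrix⁻¹ := by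
    refine (Matrix.inv_eq_right_inv ?_).symm
    rw [← h, ← map_mul, Matrix.mul_nonsing_inv _ (p.isUnit_det_fieldMatrix), map_one]
  rw [topCoeff, topCoeff, ← h']
  rfl

variable [Algebra ℚ R] [Algebra ℚ K]

theorem map_cocycle (cc : R) (m n : ℤ) :
    VirasoroWord.cocycle (φ cc) m n = φ (VirasoroWord.cocycle cc m n) := by
  unfold VirasoroWord.cocycle
  split_ifs
  · rw [map_mul, φ.map_rat_algebraMap]
  · exact (map_zero φ).symm

/-- Irregular Verma modules are compatible with base change. -/
theorem exists_baseChange : ∃ Φ : p.Verma →ₛₗ[φ] (p.map φ).Verma,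
    Φ p.vac = (p.map φ).vac ∧ ∀ n x, Φ (genU R n • x) = genU K n • Φ x := by
  let V := (p.map φ).Verma
  let _ : Module R V := Module.compHom V φ
  have hsmul : ∀ (a : R) (x : V), a • x = φ a • x := fun _ _ => rfl
  let ℓ : ℤ → Module.End R V := fun n =>
    { toFun := fun x => genU K n • x
      map_add' := fun x y => smul_add _ _ _
      map_smul' := fun a x => smul_comm (genU K n) (φ a) x }
  let ρ : Virasoro R →ₗ⁅R⁆ Module.End R V := Virasoro.repOfModes ℓ p.centralCharge (by
    intro m n
    refine LinearMap.ext fun x => ?_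
    have := (p.map φ).genU_smul_genU_smul m n x
    change ℓ m (ℓ n x) - ℓ n (ℓ m x) = ((m - n : ℤ) : R) • ℓ (m + n) x +
      VirasoroWord.cocycle p.centralCharge m n • x
    rw [hsmul, hsmul, map_intCast, ← map_cocycle, sub_eq_iff_eq_add', ← add_assoc]
    exact this)
  let ρU := UniversalEnvelopingAlgebra.lift R ρ
  have hgen : ∀ n, ρU (genU R n) = ℓ n := fun n => by
    rw [genU, UniversalEnvelopingAlgebra.lift_ι_apply]
    exact Virasoro.repOfModes_L ..
  have hcentral : ρU (UniversalEnvelopingAlgebra.ι R (Virasoro.central R)) =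
      algebraMap R _ p.centralCharge := by
    rw [UniversalEnvelopingAlgebra.lift_ι_apply]
    exact (Virasoro.repOfModes_central ..).trans (Algebra.algebraMap_eq_smul_one _).symm
  have hker : ∀ u ∈ p.vermaIdeal, ρU u (p.map φ).vac = 0 := by
    intro u hu
    induction hu using Submodule.span_induction with
    | mem u hu =>
      rcases hu with ⟨n, hn, rfl⟩ | rfl
      · rw [map_sub, AlgHom.commutes, hgen, LinearMap.sub_apply, Module.algebraMap_end_apply,
          sub_eq_zero, hsmul, ← lowerWeight_map]
        exact (p.map φ).genU_smul_vac hn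
      · rw [map_sub, AlgHom.commutes, hcentral, sub_self, LinearMap.zero_apply]
    | zero => rw [map_zero, LinearMap.zero_apply]
    | add x y _ _ hx hy => rw [map_add, LinearMap.add_apply, hx, hy, add_zero]
    | smul a x _ hx => rw [smul_eq_mul, map_mul, Module.End.mul_apply, hx, map_zero]
  let Ψ : p.Verma →+ V := QuotientAddGroup.lift p.vermaIdeal.toAddSubgroup
    { toFun := fun u => ρU u (p.map φ).vac
      map_zero' := by rw [map_zero, LinearMap.zero_apply]
      map_add' := fun u v => by rw [map_add, LinearMap.add_apply] } hker
  have hΨ : ∀ u, Ψ (Submodule.Quotient.mk u) = ρU u (p.map φ).vac := fun u => rfl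
  refine ⟨{ toFun := Ψ, map_add' := Ψ.map_add, map_smul' := fun a x => ?_ }, ?_, fun n x => ?_⟩
  · obtain ⟨u, rfl⟩ := Submodule.Quotient.mk_surjective _ x
    have : a • (Submodule.Quotient.mk u : p.Verma) = Submodule.Quotient.mk (a • u) := rfl
    rw [this, hΨ, hΨ, map_smul]
    rfl
  · change Ψ (Submodule.Quotient.mk 1) = _
    rw [hΨ, map_one, Module.End.one_apply]
  · obtain ⟨u, rfl⟩ := Submodule.Quotient.mk_surjective _ x
    change Ψ (genU R n • Submodule.Quotient.mk u) = genU K n • Ψ (Submodule.Quotient.mk u)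
    rw [← Submodule.Quotient.mk_smul, hΨ, hΨ, smul_eq_mul, map_mul, hgen]
    rfl

end IrregularParams

namespace IrregularModes

open HahnModule IrregularParams

section

variable {R K V V' : Type*} [CommRing R] [CommRing K] [AddCommGroup V] [Module R V]
  [AddCommGroup V'] [Module K V'] {φ : R →+* K} {Φ : V →ₛₗ[φ] V'}

theorem mapCoeff_ofCoeffs (v : ℕ → V) :
    mapCoeff Φ (ofCoeffs (K := R) v) = ofCoeffs (K := K) fun n => Φ (v n) := by
  refine ext_coeff fun n => ?_
  rw [coeff_mapCoeff, coeff_ofCoeffs, coeff_ofCoeffs]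
  split_ifs
  · rfl
  · exact map_zero Φ

end

variable {R K V V' : Type*} [CommRing R] [Algebra ℚ R] [CommRing K] [Algebra ℚ K]
  [AddCommGroup V] [Module R V] [AddCommGroup V'] [Module K V'] {φ : R →+* K}
  {Φ : V →ₛₗ[φ] V'} {S : IrregularModes R V} {S' : IrregularModes K V'} {r : ℕ}

theorem mapCoeff_series (hΦ : ∀ n x, Φ (S.mode n x) = S'.mode n (Φ x)) (n : ℤ)
    (F : HahnModule ℤ R V) : mapCoeff Φ (S.series n F) = S'.series n (mapCoeff Φ F) :=
  ext_coeff fun _ => hΦ n _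

theorem mapCoeff_connection (hΦ : ∀ n x, Φ (S.mode n x) = S'.mode n (Φ x))
    (p : IrregularParams R r) (hr : 2 ≤ r) (F : HahnModule ℤ R V) :
    mapCoeff Φ (S.connection p hr F) = S'.connection (p.map φ) hr (mapCoeff Φ F) := by
  have hs : ∀ (f : LaurentSeries R) (G : HahnModule ℤ R V),
      mapCoeff Φ (f • G) = laurentMap φ f • mapCoeff Φ G := fun f G => mapCoeff_smul Φ f G
  have hD : ∀ n : ℕ, mapCoeff Φ (S.seriesD p n F) = S'.seriesD (p.map φ) n (mapCoeff Φ F) := by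
    intro n
    rw [seriesD, mapCoeff_sub, mapCoeff_series hΦ, hs, apply_ite (laurentMap φ), laurentMap_C,
      laurentMap_weight]
    rfl
  rw [connection, mapCoeff_sub, hs, seriesLstar, hs, mapCoeff_sum, map_pow, map_pow,
    laurentMap_top, ← theta_mapCoeff]
  simp only [hs, hD, laurentMap_topCoeff]
  rfl

end IrregularModes

namespace IrregularSeries

variable {R K : Type*} [CommRing R] [Algebra ℚ R] [CommRing K] [Algebra ℚ K] {φ : R →+* K} {r : ℕ}
  {p : IrregularParams R r}

/-- The image of a formal series under base change. -/
noncomputable def map (Φ : p.Verma →ₛₗ[φ] (p.map φ).Verma) (W : IrregularSeries p) :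
    IrregularSeries (p.map φ) where
  ν := φ W.ν
  g i := φ (W.g i)
  v k := Φ (W.v k)

/-- Base change preserves the conditions on the formal vector. -/
theorem IsCanonical.map {hr : 2 ≤ r} (hu : IsUnit (p.lower (r - 1)))
    {Φ : p.Verma →ₛₗ[φ] (p.map φ).Verma} (h0 : Φ p.vac = (p.map φ).vac)
    (hΦ : ∀ n x, Φ (IrregularParams.genU R n • x) = IrregularParams.genU K n • Φ x)
    {W : IrregularSeries p} (hW : W.IsCanonical hr) : (W.map Φ).IsCanonical hr := by
  have hu' : IsUnit ((p.map φ).lower (r - 1)) := by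
    rw [IrregularParams.lower_map]; exact hu.map φ
  obtain ⟨h1, h2, h3⟩ := (isCanonical_iff hr hu W).1 hW
  have hs : ∀ (f : LaurentSeries R) (G : HahnModule ℤ R p.Verma),
      HahnModule.mapCoeff Φ (f • G) = IrregularParams.laurentMap φ f • HahnModule.mapCoeff Φ G :=
    fun f G => HahnModule.mapCoeff_smul Φ f G
  have hΦ' : ∀ n x, Φ ((p.modes hr hu).mode n x) = ((p.map φ).modes hr hu').mode n (Φ x) := hΦ
  refine (isCanonical_iff hr hu' _).2 ⟨?_, ?_, fun n hn hn' => ?_⟩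
  · exact (congrArg Φ h1).trans h0
  · have := congrArg (HahnModule.mapCoeff Φ) h2
    rwa [IrregularModes.mapCoeff_connection hΦ', hs, IrregularParams.laurentMap_ofPowerSeries,
      IrregularParams.map_polarPart, IrregularModes.mapCoeff_ofCoeffs] at this
  · have := congrArg (HahnModule.mapCoeff Φ) (h3 n hn hn')
    rwa [IrregularModes.mapCoeff_series hΦ', hs, IrregularParams.laurentMap_weight,
      IrregularModes.mapCoeff_ofCoeffs] at this

end IrregularSeries

namespace IrregularParams

section

variable {R K : Type*} [CommRing R] [Algebra ℚ R] [CommRing K] [Algebra ℚ K] {φ : R →+* K} {r : ℕ}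
  {p : IrregularParams R r}

/-- The constant term is compatible with base change. -/
theorem constFunctional_map (hr : 2 ≤ r) {Φ : p.Verma →ₛₗ[φ] (p.map φ).Verma}
    (h0 : Φ p.vac = (p.map φ).vac) (hΦ : ∀ n x, Φ (genU R n • x) = genU K n • Φ x) (x : p.Verma) :
    (p.map φ).constFunctional hr (Φ x) = φ (p.constFunctional hr x) := by
  have hlist : ∀ l : List ℤ, Φ ((l.map (genU R)).prod • p.vac) =
      (l.map (genU K)).prod • (p.map φ).vac := by
    intro l
    induction l with
    | nil => rw [List.map_nil, List.map_nil, List.prod_nil, List.prod_nil, one_smul, one_smul, h0]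
    | cons n l ih =>
      rw [List.map_cons, List.map_cons, List.prod_cons, List.prod_cons, mul_smul, mul_smul, hΦ, ih]
  have hpbw : ∀ {m : ℕ} (lam : m.Partition), Φ (p.pbw lam) = (p.map φ).pbw lam := by
    intro m lam
    have := hlist ((lam.parts.sort (· ≥ ·)).map fun i : ℕ => (r : ℤ) - 1 - i)
    rwa [List.map_map, List.map_map] at this
  have hx : p.IsConstantTerm x (p.constFunctional hr x) := (p.isConstantTerm_iff hr x _).2 rfl
  refine (((p.map φ).isConstantTerm_iff hr _ _).1 ?_).symm
  have e : Φ x - φ (p.constFunctional hr x) • (p.map φ).vac =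
      Φ (x - p.constFunctional hr x • p.vac) := by
    rw [map_sub, map_smulₛₗ, h0]
  rw [IsConstantTerm, e]
  have key : ∀ y ∈ Submodule.span R
      {x : p.Verma | ∃ (m : ℕ) (lam : m.Partition), 0 < m ∧ x = p.pbw lam},
      Φ y ∈ Submodule.span K
        {x : (p.map φ).Verma | ∃ (m : ℕ) (lam : m.Partition), 0 < m ∧ x = (p.map φ).pbw lam} := by
    intro y hy
    induction hy using Submodule.span_induction with
    | mem y hy =>
      obtain ⟨m, lam, hm, rfl⟩ := hy
      exact Submodule.subset_span ⟨m, lam, hm, hpbw lam⟩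
    | zero => rw [map_zero]; exact zero_mem _
    | add y z _ _ hy hz => rw [map_add]; exact add_mem hy hz
    | smul a y _ hy => rw [map_smulₛₗ]; exact Submodule.smul_mem _ _ hy
  exact key _ hx

end

/-! ### The universal parameters -/

/-- The ring of Laurent polynomials in the parameters: polynomials in all the variables modulo the
relation expressing that the last variable is inverse to `c_{r-1}`. -/
abbrev UniversalRing (r : ℕ) (hr : 2 ≤ r) : Type :=
  MvPolynomial (ParamVar r) ℚ ⧸ Ideal.span
    {(MvPolynomial.X (ParamVar.c ⟨r - 2, by omega⟩) * MvPolynomial.X ParamVar.cTopInv - 1 :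
      MvPolynomial (ParamVar r) ℚ)}

/-- The tautological parameters in the ring of Laurent polynomials. -/
noncomputable def universal (r : ℕ) (hr : 2 ≤ r) : IrregularParams (UniversalRing r hr) r where
  centralCharge := Ideal.Quotient.mk _ (MvPolynomial.X .centralCharge)
  Q := Ideal.Quotient.mk _ (MvPolynomial.X .Q)
  Δ := Ideal.Quotient.mk _ (MvPolynomial.X .Δ)
  c₀' := Ideal.Quotient.mk _ (MvPolynomial.X .c₀')
  c₀ := Ideal.Quotient.mk _ (MvPolynomial.X .c₀)
  c i := Ideal.Quotient.mk _ (MvPolynomial.X (.c i))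

theorem lower_sub_one {K : Type*} [CommRing K] {r : ℕ} (hr : 2 ≤ r) (p : IrregularParams K r) :
    p.lower (r - 1) = p.c ⟨r - 2, by omega⟩ := by
  rw [lower, dif_pos ⟨by omega, le_rfl⟩]
  rfl

theorem isUnit_lower_universal {r : ℕ} (hr : 2 ≤ r) :
    IsUnit ((universal r hr).lower (r - 1)) := by
  rw [lower_sub_one hr]
  refine IsUnit.of_mul_eq_one (Ideal.Quotient.mk _ (MvPolynomial.X .cTopInv)) ?_
  rw [universal, ← map_mul, ← map_one (Ideal.Quotient.mk _), Ideal.Quotient.eq]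
  exact Ideal.subset_span rfl

/-- Every choice of parameters with `c_{r-1}` invertible is a specialization of the tautological
one. -/
theorem exists_specialization {K : Type*} [CommRing K] [Algebra ℚ K] {r : ℕ} (hr : 2 ≤ r)
    (p : IrregularParams K r) (hu : IsUnit (p.lower (r - 1))) :
    ∃ φ : UniversalRing r hr →+* K, (universal r hr).map φ = p ∧
      ∀ f, φ (Ideal.Quotient.mk _ f) = MvPolynomial.aeval p.value f := by
  let φ : UniversalRing r hr →+* K := Ideal.Quotient.lift _
    (MvPolynomial.aeval p.value : MvPolynomial (ParamVar r) ℚ →ₐ[ℚ] K).toRingHom (by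
      intro f hf
      refine (Ideal.span_le (I := RingHom.ker _)).2 ?_ hf
      rintro _ rfl
      refine (RingHom.mem_ker).2 ?_
      change MvPolynomial.aeval p.value _ = 0
      rw [map_sub, map_mul, MvPolynomial.aeval_X, MvPolynomial.aeval_X, map_one]
      change p.c _ * Ring.inverse (p.lower (r - 1)) - 1 = 0
      rw [← lower_sub_one hr, Ring.mul_inverse_cancel _ hu, sub_self])
  have hφ : ∀ f, φ (Ideal.Quotient.mk _ f) = MvPolynomial.aeval p.value f := fun f => rfl
  refine ⟨φ, ?_, hφ⟩
  obtain ⟨a, b, c, d, e, f⟩ := p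
  simp only [universal, map, hφ, MvPolynomial.aeval_X]
  rfl

end IrregularParams

theorem mainTheorem1 (r : ℕ) (hr : 2 ≤ r) :
    ∃ (νPoly : MvPolynomial (ParamVar r) ℚ)
      (gPoly : Fin (r - 1) → MvPolynomial (ParamVar r) ℚ)
      (constPoly : ℕ → MvPolynomial (ParamVar r) ℚ),
      ∀ (K : Type*) [CommRing K] [Algebra ℚ K] (p : IrregularParams K r),
        IsUnit (p.lower (r - 1)) →
          (∃! W : IrregularSeries p, W.IsCanonical hr) ∧
          ∀ W : IrregularSeries p, W.IsCanonical hr →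
            W.ν = MvPolynomial.aeval p.value νPoly ∧
            (∀ i, W.g i = MvPolynomial.aeval p.value (gPoly i)) ∧
            ∀ (k : ℕ) (a : K), p.IsConstantTerm (W.v k) a ↔
              a = MvPolynomial.aeval p.value (constPoly k) := by
  have hu₀ := IrregularParams.isUnit_lower_universal hr
  obtain ⟨W₀, hW₀, -⟩ := IrregularSeries.existsUnique_isCanonical hr hu₀
  obtain ⟨νPoly, hν⟩ := Ideal.Quotient.mk_surjective W₀.ν
  choose gPoly hg using fun i => Ideal.Quotient.mk_surjective (W₀.g i)
  choose constPoly hconst using fun k => Ideal.Quotient.mk_surjective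
    ((IrregularParams.universal r hr).constFunctional hr (W₀.v k))
  refine ⟨νPoly, gPoly, constPoly, fun K _ _ p hu => ?_⟩
  obtain ⟨φ, rfl, hφ⟩ := p.exists_specialization hr hu
  have hex := IrregularSeries.existsUnique_isCanonical hr hu
  obtain ⟨Φ, h0, hΦ⟩ := IrregularParams.exists_baseChange φ (IrregularParams.universal r hr)
  refine ⟨hex, fun W hW => ?_⟩
  obtain rfl : W = W₀.map Φ := hex.unique hW (hW₀.map hu₀ h0 hΦ)
  refine ⟨?_, fun i => ?_, fun k a => ?_⟩
  · rw [← hφ, hν]; rfl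
  · rw [← hφ, hg]; rfl
  · rw [IrregularParams.isConstantTerm_iff _ hr, ← hφ, hconst]
    exact Eq.congr_right (IrregularParams.constFunctional_map hr h0 hΦ _)
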